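/- **Setting.** Consider an unknown system $x_{t+1}=f_\theta(x_t,u_t)+v_t$, $y_t=g_\theta(x_t,u_t)+w_t$ with $x_t\in\mathbb R^{n_x}$, $u_t\in\mathbb R^{n_u}$, $y_t\in\mathbb R^{n_y}$. The parametric model $(f_\theta,g_\theta,\mathcal V_\theta,\mathcal W_\theta)$, $\theta\in\mathbb R^{n_\theta}$, is known. The parameters and the initial state $x_T$ ($T<0$) are drawn from independent priors. Given $\theta$, all noise variables are independent with $v_t\sim\mathcal V_\theta$, $w_t\sim\mathcal W_\theta$. The data set is $\mathbb D=(u_t,y_t)_{t=T}^{-1}$, where each past input may depend on earlier inputs and outputs and on independent randomness. Everything below is conditional on $\mathbb D$ and holds for almost every value of $\mathbb D$. A scenario is $\delta=(\theta,x_0,v_{0:H},w_{0:H})$. It is generated by drawing $(\theta,x_{T:-1})$ from the posterior $p(\theta,x_{T:-1}\mid\mathbb D)$ and fresh noise from $\mathcal V_\theta,\mathcal W_\theta$, with $x_0=f_\theta(x_{-1},u_{-1})+v_{-1}$. Let $\delta^{[1]},\dots,\delta^{[K]}$ be $K$ independent scenarios, and let $y_{0:H}^{\delta}(u_{0:H})$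 be the output obtained by simulating $\delta$ forward under the inputs $u_{0:H}$. Let $J_H(u_{0:H},y_{0:H})=c_H(y_H)+\sum_{t=0}^H c(u_t,y_t)$, let $h$ be a real-valued constraint function, and let $\mathbb H_\delta=\{u_{0:H}: h(u_{0:H},y_{0:H}^{\delta}(u_{0:H}))\le 0\}$. For scenarios $\delta^{[1]},\dots,\delta^{[n]}$, let $M_n(\delta^{[1]},\dots,\delta^{[n]})$ be the result of a deterministic solver for the problem $$\min_{u_{0:H}}\ \frac1n\sum_{k=1}^n J_H\big(u_{0:H},y_{0:H}^{\delta^{[k]}}(u_{0:H})\big)\quad\text{subject to}\quad u_{0:H}\in\mathbb H_{\delta^{[k]}},\ k=1,\dots,n .$$ Assume that for all $n\ge1$, $k\ge 1$ and all scenarios: (i) $M_n$ is invariant under permutations of its arguments; (ii) if $M_n(\delta^{[1]},\dots,\delta^{[n]})\in\mathbb H_{\delta^{[n+i]}}$ for all $i=1,\dots,k$, then $M_{n+k}(\delta^{[1]},\dots,\delta^{[n+k]})=M_n(\delta^{[1]},\dots,\delta^{[n]})$; (iii) if $M_n(\delta^{[1]},\dots,\delta^{[n]})\notin\mathbb H_{\delta^{[n+i]}}$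 for at least one $i\in\{1,\dots,k\}$, then $M_{n+k}(\delta^{[1]},\dots,\delta^{[n+k]})\ne M_n(\delta^{[1]},\dots,\delta^{[n]})$. **Theorem.** Let $\beta\in(0,1)$. For every $s\in\{0,\dots,K-1\}$ the equation $$\binom Ks(1-v)^{K-s}-\frac\beta K\sum_{m=s}^{K-1}\binom ms(1-v)^{m-s}=0$$ has exactly one solution $v=\varepsilon(s)$ in $(0,1)$. Let $u^\star=M_K(\delta^{[1]},\dots,\delta^{[K]})$, and let $V_c$ be the conditional probability, given $\mathbb D$, that $h(u_{0:H},y_{0:H})>0$ when $u_{0:H}=u^\star$ is applied to the unknown system. Then, with probability at least $1-\beta$ over the $K$ scenarios, the following holds: if $u^\star$ is feasible for all $K$ scenarios, and $S\subseteq\{1,\dots,K\}$ is any set of $s<K$ indices whose scenarios alone reproduce $u^\star$, i.e. $M_s\big((\delta^{[k]})_{k\in S}\big)=u^\star$, then $V_c\le\varepsilon(s)$. (The empty set counts as such an $S$ only if (ii) and (iii) also hold for $n=0$.) -/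

import Mathlib

open MeasureTheory ProbabilityTheory

noncomputable section

namespace ScenarioOCP

/-! ### Parametric state-space models -/

/-- Real column vectors of length `n` (only the measurable and additive structure is used). -/
abbrev Vec (n : ℕ) : Type := Fin n → ℝ

/-- A parametric model `(f_θ, g_θ, 𝒱_θ, 𝒲_θ)` of a nonlinear system
`x_{t+1} = f_θ(x_t, u_t) + v_t`, `y_t = g_θ(x_t, u_t) + w_t` with `v_t ∼ 𝒱_θ`, `w_t ∼ 𝒲_θ`. -/
structure Model (nθ nx nu ny : ℕ) where
  /-- transition function -/
  f : Vec nθ → Vec nx → Vec nu → Vec nx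
  /-- observation function -/
  g : Vec nθ → Vec nx → Vec nu → Vec ny
  /-- law of the process noise, given the parameters -/
  procNoise : Kernel (Vec nθ) (Vec nx)
  /-- law of the measurement noise, given the parameters -/
  measNoise : Kernel (Vec nθ) (Vec ny)
  measurable_f : Measurable fun p : Vec nθ × Vec nx × Vec nu => f p.1 p.2.1 p.2.2
  measurable_g : Measurable fun p : Vec nθ × Vec nx × Vec nu => g p.1 p.2.1 p.2.2
  markov_procNoise : IsMarkovKernel procNoise
  markov_measNoise : IsMarkovKernel measNoise

attribute [instance] Model.markov_procNoise Model.markov_measNoise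

/-- The law of `n` i.i.d. draws from `κ θ`, as a kernel in `θ`. -/
def iidKernel {α β : Type*} [MeasurableSpace α] [MeasurableSpace β] (κ : Kernel α β)
    [IsMarkovKernel κ] (n : ℕ) : Kernel α (Fin n → β) where
  toFun a := Measure.pi fun _ => κ a
  measurable' := by
    refine Measurable.measure_of_isPiSystem_of_isProbabilityMeasure
      (S := Set.pi Set.univ '' Set.pi Set.univ fun _ : Fin n => {s : Set β | MeasurableSet s})
      generateFrom_pi.symm isPiSystem_pi ?_
    rintro _ ⟨s, hs, rfl⟩
    simp only [Measure.pi_pi]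
    exact Finset.measurable_prod _ fun i _ => κ.measurable_coe (hs i (Set.mem_univ i))

instance {α β : Type*} [MeasurableSpace α] [MeasurableSpace β] (κ : Kernel α β)
    [IsMarkovKernel κ] (n : ℕ) : IsMarkovKernel (iidKernel κ n) :=
  ⟨fun a => inferInstanceAs (IsProbabilityMeasure (Measure.pi fun _ : Fin n => κ a))⟩

/-- The Bayesian setting: a parametric model, independent priors for the parameters and for the
state at the time `T` of the first measurement, and the way in which the past inputs were chosen.
The past input number `n` is a function of the earlier inputs and outputs and of a random
element of `R`, which is independent of the system and of the noise (open-loop, random and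
feedback excitation are all of this form). -/
structure Setting (nθ nx nu ny : ℕ) (R : Type*) [MeasurableSpace R] extends
    Model nθ nx nu ny where
  /-- prior of the parameters -/
  priorParam : Measure (Vec nθ)
  /-- prior of the initial state `x_T` -/
  priorState : Measure (Vec nx)
  /-- law of the exogenous randomness in the past inputs -/
  exo : Measure R
  /-- the rule that generated the past inputs -/
  input : (n : ℕ) → R → (Fin n → Vec nu × Vec ny) → Vec nu
  prob_priorParam : IsProbabilityMeasure priorParam
  prob_priorState : IsProbabilityMeasure priorState
  prob_exo : IsProbabilityMeasure exo
  measurable_input : ∀ n, Measurable fun p : R × (Fin n → Vec nu × Vec ny) => input n p.1 p.2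

attribute [instance] Setting.prob_priorParam Setting.prob_priorState Setting.prob_exo

section

variable {nθ nx nu ny : ℕ} {R : Type*} [MeasurableSpace R]

/-! ### The past: data set and posterior

There are `L + 1` past measurements, at the times `T = -(L + 1), …, -1`; entry `j : Fin (L + 1)`
of a past sequence belongs to the time `T + j`, so that `Fin.last L` stands for the time `-1`.
The future times are `0, …, H`, represented by `Fin (H + 1)`. -/

/-- The data set `𝔻 = (u_t, y_t)_{t = T, …, -1}`. -/
abbrev Data (nu ny L : ℕ) : Type := Fin (L + 1) → Vec nu × Vec ny

/-- Everything random about the unknown system: the parameters, the initial state `x_T`, the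
exogenous randomness of the past inputs, the noise `v`, `w` at the past times `T, …, -1`,
and the noise `v`, `w` at the future times `0, …, H`. -/
abbrev Truth (nθ nx ny : ℕ) (R : Type*) (L H : ℕ) : Type _ :=
  Vec nθ × Vec nx × R × (Fin (L + 1) → Vec nx) × (Fin (L + 1) → Vec ny) ×
    (Fin (H + 1) → Vec nx) × (Fin (H + 1) → Vec ny)

/-- The law of the unknown system: parameters and initial state are drawn from the prior; given
the parameters, all noise variables are independent, with laws `𝒱_θ` and `𝒲_θ`. -/
def Setting.truthLaw (𝔖 : Setting nθ nx nu ny R) (L H : ℕ) : Measure (Truth nθ nx ny R L H) :=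
  𝔖.priorParam ⊗ₘ
    (Kernel.const (Vec nθ) 𝔖.priorState ×ₖ (Kernel.const (Vec nθ) 𝔖.exo ×ₖ
      (iidKernel 𝔖.procNoise (L + 1) ×ₖ (iidKernel 𝔖.measNoise (L + 1) ×ₖ
        (iidKernel 𝔖.procNoise (H + 1) ×ₖ iidKernel 𝔖.measNoise (H + 1))))))

instance (𝔖 : Setting nθ nx nu ny R) (L H : ℕ) : IsProbabilityMeasure (𝔖.truthLaw L H) := by
  unfold Setting.truthLaw
  infer_instance

/-- The first `n` input-output pairs and the first `n + 1` states of the system with parameters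
`θ`, started in `xT` and driven by the noise sequences `v`, `w` and the past input rule. -/
def Setting.run (𝔖 : Setting nθ nx nu ny R) (θ : Vec nθ) (xT : Vec nx) (r : R) :
    (n : ℕ) → (Fin n → Vec nx) → (Fin n → Vec ny) →
      (Fin n → Vec nu × Vec ny) × (Fin (n + 1) → Vec nx)
  | 0, _, _ => (Fin.elim0, fun _ => xT)
  | n + 1, v, w =>
    let past := 𝔖.run θ xT r n (Fin.init v) (Fin.init w)
    let x := past.2 (Fin.last n)
    let u := 𝔖.input n r past.1
    (Fin.snoc (α := fun _ => Vec nu × Vec ny) past.1 (u, 𝔖.g θ x u + w (Fin.last n)),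
      Fin.snoc (α := fun _ => Vec nx) past.2 (𝔖.f θ x u + v (Fin.last n)))

/-- Past input-output pairs and past states (the states at times `T, …, 0`). -/
def Setting.pastOf (𝔖 : Setting nθ nx nu ny R) {L H : ℕ} (τ : Truth nθ nx ny R L H) :
    Data nu ny L × (Fin (L + 2) → Vec nx) :=
  𝔖.run τ.1 τ.2.1 τ.2.2.1 (L + 1) τ.2.2.2.1 τ.2.2.2.2.1

/-- The data set that the unknown system produces. -/
def Setting.dataOf (𝔖 : Setting nθ nx nu ny R) {L H : ℕ} (τ : Truth nθ nx ny R L H) :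
    Data nu ny L :=
  (𝔖.pastOf τ).1

/-- Parameters and latent state trajectory `(θ, x_{T:-1})` of the unknown system. -/
def Setting.latentOf (𝔖 : Setting nθ nx nu ny R) {L H : ℕ} (τ : Truth nθ nx ny R L H) :
    Vec nθ × (Fin (L + 1) → Vec nx) :=
  (τ.1, Fin.init (𝔖.pastOf τ).2)

/-- The law of the data set. -/
def Setting.dataLaw (𝔖 : Setting nθ nx nu ny R) (L H : ℕ) : Measure (Data nu ny L) :=
  (𝔖.truthLaw L H).map 𝔖.dataOf

/-- The posterior distribution `p(θ, x_{T:-1} ∣ 𝔻)`. -/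
def Setting.posterior (𝔖 : Setting nθ nx nu ny R) (L H : ℕ) :
    Kernel (Data nu ny L) (Vec nθ × (Fin (L + 1) → Vec nx)) :=
  condDistrib 𝔖.latentOf 𝔖.dataOf (𝔖.truthLaw L H)

/-! ### Scenarios -/

/-- A scenario `δ = (θ, x_0, v_{0:H}, w_{0:H})`. -/
abbrev Scenario (nθ nx ny H : ℕ) : Type :=
  Vec nθ × Vec nx × (Fin (H + 1) → Vec nx) × (Fin (H + 1) → Vec ny)

/-- The law of one generated scenario, given the data set: draw `(θ, x_{T:-1})` from the
posterior, draw fresh noise `v_{-1}`, `v_{0:H}`, `w_{0:H}`, and put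
`x_0 = f_θ(x_{-1}, u_{-1}) + v_{-1}`. -/
def Setting.scenarioLaw (𝔖 : Setting nθ nx nu ny R) (L H : ℕ) (d : Data nu ny L) :
    Measure (Scenario nθ nx ny H) :=
  (𝔖.posterior L H d ⊗ₘ
    Kernel.comap
      (𝔖.procNoise ×ₖ (iidKernel 𝔖.procNoise (H + 1) ×ₖ iidKernel 𝔖.measNoise (H + 1)))
      Prod.fst measurable_fst).map
    fun p => (p.1.1, 𝔖.f p.1.1 (p.1.2 (Fin.last L)) (d (Fin.last L)).1 + p.2.1, p.2.2.1, p.2.2.2)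

/-- The actual scenario: parameters, state at time `0` and future noise of the unknown system. -/
def Setting.trueScenarioOf (𝔖 : Setting nθ nx nu ny R) {L H : ℕ} (τ : Truth nθ nx ny R L H) :
    Scenario nθ nx ny H :=
  (τ.1, (𝔖.pastOf τ).2 (Fin.last (L + 1)), τ.2.2.2.2.2.1, τ.2.2.2.2.2.2)

/-- An input trajectory `u_{0:H}`. -/
abbrev Inputs (nu H : ℕ) : Type := Fin (H + 1) → Vec nu

/-- An output trajectory `y_{0:H}`. -/
abbrev Outputs (ny H : ℕ) : Type := Fin (H + 1) → Vec ny

/-- Forward simulation of the state: `x_{t+1} = f_θ(x_t, u_t) + v_t`, started in `x_0`. -/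
def Model.simState (M : Model nθ nx nu ny) {H : ℕ} (δ : Scenario nθ nx ny H) (u : Inputs nu H)
    (t : Fin (H + 1)) : Vec nx :=
  Fin.induction (motive := fun _ => Vec nx) δ.2.1
    (fun i x => M.f δ.1 x (u i.castSucc) + δ.2.2.1 i.castSucc) t

/-- Forward simulation of the output: `y_t = g_θ(x_t, u_t) + w_t`. -/
def Model.simOutput (M : Model nθ nx nu ny) {H : ℕ} (δ : Scenario nθ nx ny H)
    (u : Inputs nu H) : Outputs ny H :=
  fun t => M.g δ.1 (M.simState δ u t) (u t) + δ.2.2.2 t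

/-! ### The scenario optimal control problem -/

/-- The data of a control task: stage cost, terminal cost, and the constraint function `h` of
the constraint `h(u_{0:H}, y_{0:H}) ≤ 0`. -/
structure Task (nu ny H : ℕ) where
  /-- stage cost -/
  c : Vec nu → Vec ny → ℝ
  /-- terminal cost -/
  cH : Vec ny → ℝ
  /-- constraint function -/
  h : Inputs nu H → Outputs ny H → ℝ
  measurable_h : Measurable fun p : Inputs nu H × Outputs ny H => h p.1 p.2

/-- The accumulated cost `J_H = c_H(y_H) + ∑_{t=0}^H c(u_t, y_t)`. -/
def Task.J {H : ℕ} (P : Task nu ny H) (u : Inputs nu H) (y : Outputs ny H) : ℝ :=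
  P.cH (y (Fin.last H)) + ∑ t, P.c (u t) (y t)

/-- A nonlinear program in the variable `u : U`: minimize `objective u` subject to
`constraint i u ≤ 0` for `i = 1, …, n`. -/
structure NLP (U : Type*) (n : ℕ) where
  /-- the objective -/
  objective : U → ℝ
  /-- the constraint functions -/
  constraint : Fin n → U → ℝ

/-- `u` satisfies all constraints of the program. -/
def NLP.Feasible {U : Type*} {n : ℕ} (Q : NLP U n) (u : U) : Prop :=
  ∀ i, Q.constraint i u ≤ 0

/-- The scenario optimal control problem of the scenarios `δ^{[1]}, …, δ^{[n]}`: minimize the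
sample mean of the cost subject to the constraints of all scenarios. -/
def Task.ocp {H : ℕ} (P : Task nu ny H) (M : Model nθ nx nu ny) {n : ℕ}
    (δ : Fin n → Scenario nθ nx ny H) : NLP (Inputs nu H) n where
  objective u := 1 / (n : ℝ) * ∑ k, P.J u (M.simOutput (δ k) u)
  constraint k u := P.h u (M.simOutput (δ k) u)

/-- A (deterministic) solver: it assigns an input trajectory to every nonlinear program.
Nothing is required of the result. -/
abbrev Solver (nu H : ℕ) : Type := (n : ℕ) → NLP (Inputs nu H) n → Inputs nu H

/-- The mapping `M_n` from `n` scenarios to the solver's result for their scenario optimal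
control problem. -/
def Solver.solution {H : ℕ} (solver : Solver nu H) (P : Task nu ny H) (M : Model nθ nx nu ny)
    (n : ℕ) (δ : Fin n → Scenario nθ nx ny H) : Inputs nu H :=
  solver n (P.ocp M δ)

/-- The set `ℍ_δ` of the input trajectories that are suitable for the scenario `δ`. -/
def Task.suitable {H : ℕ} (P : Task nu ny H) (M : Model nθ nx nu ny)
    (δ : Scenario nθ nx ny H) : Set (Inputs nu H) :=
  {u | P.h u (M.simOutput δ u) ≤ 0}

/-- The conditional distribution of the actual scenario of the unknown system, given the data
set. -/
def Setting.trueScenarioLaw (𝔖 : Setting nθ nx nu ny R) (L H : ℕ) :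
    Kernel (Data nu ny L) (Scenario nθ nx ny H) :=
  condDistrib 𝔖.trueScenarioOf 𝔖.dataOf (𝔖.truthLaw L H)

/-- The probability, given the data set `d`, that the constraint is violated when the input
trajectory `u` is applied to the unknown system. -/
def Setting.violation (𝔖 : Setting nθ nx nu ny R) {H : ℕ} (P : Task nu ny H) (L : ℕ)
    (d : Data nu ny L) (u : Inputs nu H) : ℝ :=
  (𝔖.trueScenarioLaw L H d).real {δ | 0 < P.h u (𝔖.toModel.simOutput δ u)}

end

/-! ### Properties of the solver -/

section

variable {Δ U : Type*}

/-- Permutation invariance and consistency of a family of maps `M_n : Δⁿ → U` with respect to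
the sets `ℍ_δ ⊆ U`, for samples of size `n`. -/
structure ConsistentAt (M : (n : ℕ) → (Fin n → Δ) → U) (ℍ : Δ → Set U) (n : ℕ) : Prop where
  /-- The order of the scenarios does not matter. -/
  perm : ∀ (δ : Fin n → Δ) (σ : Equiv.Perm (Fin n)), M n (fun i => δ (σ i)) = M n δ
  /-- Additional scenarios for which the result is suitable do not change it. -/
  stable : ∀ (k : ℕ), 1 ≤ k → ∀ (δ : Fin n → Δ) (δ' : Fin k → Δ),
    (∀ i, M n δ ∈ ℍ (δ' i)) → M n δ = M (n + k) (Fin.append δ δ')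
  /-- Additional scenarios for one of which the result is not suitable change it. -/
  responsive : ∀ (k : ℕ), 1 ≤ k → ∀ (δ : Fin n → Δ) (δ' : Fin k → Δ),
    (∃ i, M n δ ∉ ℍ (δ' i)) → M n δ ≠ M (n + k) (Fin.append δ δ')

/-- `S` is a support set of the sample `δ`: the scenarios in `S` alone, listed in increasing
order of their indices, lead to the same result as the whole sample. -/
def IsSupportSet (M : (n : ℕ) → (Fin n → Δ) → U) {K : ℕ} (δ : Fin K → Δ)
    (S : Finset (Fin K)) : Prop :=
  M S.card (fun i => δ (S.orderEmbOfFin rfl i)) = M K δ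

end

/-- The left-hand side of the polynomial equation
`binom(K,s) (1-v)^{K-s} - (β/K) ∑_{m=s}^{K-1} binom(m,s) (1-v)^{m-s} = 0`. -/
def riskPoly (K s : ℕ) (β v : ℝ) : ℝ :=
  (K.choose s : ℝ) * (1 - v) ^ (K - s) -
    β / K * ∑ m ∈ Finset.Ico s K, (m.choose s : ℝ) * (1 - v) ^ (m - s)

end ScenarioOCP

end

/-! Fix the data and let `μ` be the law of one scenario. The core is a duality argument about `K`
independent draws from `μ`. Among the proper support sets of the sample at whose size the solver is
consistent, select one, `S`, by a fixed injective rank. Let `p` be the `μ`-probability that the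
result for `S` suits a new scenario, so that the risk is `1 - p`.

Take any `T ⊇ S`. If `S` is selected for the whole sample, then it is selected already for `T`, and
its result suits every scenario outside `T` (`IsSelected.of_subset`, `IsSelected.suitable`).
Selection for `T` depends only on the scenarios in `T`, and the remaining `K - |T|` are independent
of them. Hence the integral of `p ^ (-(K - |T|))` over the event that `S` is selected for the whole
sample is at most the probability that `S` is selected for `T` (`setLIntegral_isSelected_le`). For
fixed `T` these latter events are disjoint in `S`, so their probabilities add up to at most one.

Now give each proper index set `T` the weight `β / (K * binom(K, |T|))`; the total weight is at most
`β` (`sum_weights_le`). The polynomial equation says exactly that, at `p = 1 - ε |S|`, the weighted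
sum of `p ^ (-(K - |T|))` over the proper `T ⊇ S` equals one. It is therefore at least one wherever
the risk exceeds `ε |S|` (`one_le_sum_supersets_ennreal`). Integrating and summing over `S` bounds
the probability of that event by `β` (`measure_iUnion_badSet_le`). Ranking by `ε |S|` first makes
the bound valid for all admissible support sets at once.

It remains to identify `μ` with the conditional law of the actual scenario. The noise `v_{-1},
v_{0:H}, w_{0:H}` affects neither the data nor `x_{T:-1}`, and given the parameters it is
independent of them; redrawing it preserves the joint law (`Setting.lintegral_redraw`). Almost sure
uniqueness of conditional distributions then gives `Setting.ae_trueScenarioLaw_eq`. -/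

noncomputable section

namespace ScenarioOCP

/-! ### The polynomial equation for the risk level -/

/-- `riskPoly K s β (1 - x)` divided by `x ^ (K - s)`. -/
def scaledRisk (K s : ℕ) (β x : ℝ) : ℝ :=
  (K.choose s : ℝ) - β / K * ∑ m ∈ Finset.Ico s K, (m.choose s : ℝ) * (x ^ (K - m))⁻¹

lemma riskPoly_one_sub (K s : ℕ) (β : ℝ) {x : ℝ} (hx : 0 < x) :
    riskPoly K s β (1 - x) = x ^ (K - s) * scaledRisk K s β x := by
  have h : ∀ m ∈ Finset.Ico s K, (m.choose s : ℝ) * x ^ (m - s) =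
      x ^ (K - s) * ((m.choose s : ℝ) * (x ^ (K - m))⁻¹) := by
    intro m hm
    obtain ⟨h1, h2⟩ := Finset.mem_Ico.1 hm
    rw [show K - s = (m - s) + (K - m) by omega, pow_add]
    field_simp
  rw [riskPoly, scaledRisk, sub_sub_cancel, Finset.sum_congr rfl h, ← Finset.mul_sum]
  ring

/-- After division by the power, only negative powers of `x` with positive coefficients are
subtracted; every exponent `K - m` is at least one. This makes the root unique. -/
lemma scaledRisk_strictMonoOn {K s : ℕ} (hs : s < K) {β : ℝ} (hβ : 0 < β) :
    StrictMonoOn (scaledRisk K s β) (Set.Ioi 0) := by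
  intro x hx y hy hxy
  have hK : (0 : ℝ) < K := by exact_mod_cast (Nat.zero_le s).trans_lt hs
  unfold scaledRisk
  refine sub_lt_sub_left (mul_lt_mul_of_pos_left ?_ (div_pos hβ hK)) _
  refine Finset.sum_lt_sum_of_nonempty (Finset.nonempty_Ico.2 hs) fun m hm => ?_
  obtain ⟨h1, h2⟩ := Finset.mem_Ico.1 hm
  have hc : (0 : ℝ) < m.choose s := by exact_mod_cast Nat.choose_pos h1
  have hx : (0 : ℝ) < x := hx
  refine mul_lt_mul_of_pos_left ?_ hc
  exact inv_strictAnti₀ (pow_pos hx _) (pow_lt_pow_left₀ hxy hx.le (by omega))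

/-- The sum has at most `K` terms, none larger than `binom(K,s)`, so at most the fraction `β < 1` of
the leading term is subtracted. -/
lemma riskPoly_zero_pos {K s : ℕ} (hs : s < K) {β : ℝ} (hβ : β ∈ Set.Ioo (0 : ℝ) 1) :
    0 < riskPoly K s β 0 := by
  have hK : (0 : ℝ) < K := by exact_mod_cast (Nat.zero_le s).trans_lt hs
  have hc : (0 : ℝ) < K.choose s := by exact_mod_cast Nat.choose_pos hs.le
  have h : ∑ m ∈ Finset.Ico s K, (m.choose s : ℝ) ≤ K * K.choose s := by
    calc ∑ m ∈ Finset.Ico s K, (m.choose s : ℝ) ≤ ∑ m ∈ Finset.Ico s K, (K.choose s : ℝ) := by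
          refine Finset.sum_le_sum fun m hm => ?_
          exact_mod_cast Nat.choose_le_choose s (Finset.mem_Ico.1 hm).2.le
      _ = ((K - s : ℕ) : ℝ) * K.choose s := by simp
      _ ≤ K * K.choose s := by gcongr; exact Nat.sub_le _ _
  simp only [riskPoly, sub_zero, one_pow, mul_one]
  have h2 : β / K * ∑ m ∈ Finset.Ico s K, (m.choose s : ℝ) ≤ β * K.choose s := by
    calc _ ≤ β / K * (K * K.choose s) :=
          mul_le_mul_of_nonneg_left h (div_pos hβ.1 hK).le
      _ = β * K.choose s := by field_simp
  nlinarith [hβ.2]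

lemma riskPoly_one_neg {K s : ℕ} (hs : s < K) {β : ℝ} (hβ : 0 < β) : riskPoly K s β 1 < 0 := by
  have hK : (0 : ℝ) < K := by exact_mod_cast (Nat.zero_le s).trans_lt hs
  -- Only `m = s` survives, through `0 ^ 0 = 1`.
  have h : ∑ m ∈ Finset.Ico s K, (m.choose s : ℝ) * (0 : ℝ) ^ (m - s) = 1 := by
    rw [Finset.sum_eq_single s]
    · simp
    · intro m hm hne
      obtain ⟨h1, -⟩ := Finset.mem_Ico.1 hm
      simp [show m - s ≠ 0 by omega]
    · simp [hs]
  rw [riskPoly, sub_self, h, zero_pow (by omega)]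
  simp only [mul_zero, mul_one, zero_sub, Left.neg_neg_iff]
  exact div_pos hβ hK

lemma exists_riskPoly_eq_zero {K s : ℕ} (hs : s < K) {β : ℝ} (hβ : β ∈ Set.Ioo (0 : ℝ) 1) :
    ∃ v ∈ Set.Ioo (0 : ℝ) 1, riskPoly K s β v = 0 := by
  have hc : ContinuousOn (riskPoly K s β) (Set.Icc 0 1) := by
    unfold riskPoly
    fun_prop
  exact intermediate_value_Ioo' zero_le_one hc ⟨riskPoly_one_neg hs hβ.1, riskPoly_zero_pos hs hβ⟩

lemma scaledRisk_one_sub_eq_zero {K s : ℕ} {β v : ℝ} (hv : v < 1) (h : riskPoly K s β v = 0) :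
    scaledRisk K s β (1 - v) = 0 := by
  have hx : 0 < 1 - v := sub_pos.2 hv
  have h1 := riskPoly_one_sub K s β hx
  rw [sub_sub_cancel, h] at h1
  exact (mul_eq_zero.1 h1.symm).resolve_left (pow_pos hx _).ne'

lemma riskPoly_root_unique {K s : ℕ} (hs : s < K) {β : ℝ} (hβ : 0 < β) {v w : ℝ}
    (hv : v < 1) (hw : w < 1) (h : riskPoly K s β v = 0) (h' : riskPoly K s β w = 0) : v = w := by
  have := (scaledRisk_strictMonoOn hs hβ).injOn (Set.mem_Ioi.2 (sub_pos.2 hv))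
    (Set.mem_Ioi.2 (sub_pos.2 hw))
    ((scaledRisk_one_sub_eq_zero hv h).trans (scaledRisk_one_sub_eq_zero hw h').symm)
  linarith

lemma scaledRisk_nonpos {K s : ℕ} (hs : s < K) {β : ℝ} (hβ : 0 < β) {v x : ℝ}
    (hx : 0 < x) (hv : x < 1 - v) (h : riskPoly K s β v = 0) : scaledRisk K s β x ≤ 0 := by
  have h0 := scaledRisk_strictMonoOn hs hβ (Set.mem_Ioi.2 hx) (Set.mem_Ioi.2 (hx.trans hv)) hv
  rw [scaledRisk_one_sub_eq_zero (by linarith) h] at h0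
  exact h0.le

/-! ### Sums over the supersets of a set of indices -/

/-- A superset of `S` is `S` together with a subset of its complement, so `binom(K - |S|, m - |S|)`
of them have size `m`. -/
lemma sum_supersets_card {K : ℕ} (S : Finset (Fin K)) (F : ℕ → ℝ) :
    ∑ T with S ⊆ T ∧ T ≠ Finset.univ, F T.card =
      ∑ m ∈ Finset.Ico S.card K, ((K - S.card).choose (m - S.card) : ℝ) * F m := by
  classical
  have hSK : S.card ≤ K := by simpa using Finset.card_le_univ S
  have h1 : ∑ T with S ⊆ T ∧ T ≠ Finset.univ, F T.card =
      ∑ A ∈ Sᶜ.powerset, if S.card + A.card < K then F (S.card + A.card) else 0 := by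
    rw [← Finset.sum_filter]
    refine Finset.sum_bij' (fun T _ => T \ S) (fun A _ => S ∪ A) ?_ ?_ ?_ ?_ ?_
    · intro T hT
      obtain ⟨h, hne⟩ := (Finset.mem_filter.1 hT).2
      simp only [Finset.mem_filter, Finset.mem_powerset]
      refine ⟨fun i hi => by simpa using (Finset.mem_sdiff.1 hi).2, ?_⟩
      rw [add_comm, Finset.card_sdiff_add_card_eq_card h]
      have := Finset.card_lt_card (Finset.ssubset_univ_iff.2 hne)
      simpa using this
    · intro A hA
      obtain ⟨h, hlt⟩ := Finset.mem_filter.1 hA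
      simp only [Finset.mem_filter, Finset.mem_univ, true_and]
      refine ⟨Finset.subset_union_left, fun he => ?_⟩
      have := Finset.card_union_le S A
      rw [he, Finset.card_univ, Fintype.card_fin] at this
      omega
    · intro T hT
      exact Finset.union_sdiff_of_subset (Finset.mem_filter.1 hT).2.1
    · intro A hA
      have h := Finset.mem_powerset.1 (Finset.mem_filter.1 hA).1
      refine Finset.union_sdiff_cancel_left ?_
      exact (disjoint_compl_right).mono_right h
    · intro T hT
      rw [add_comm, Finset.card_sdiff_add_card_eq_card (Finset.mem_filter.1 hT).2.1]
  -- The guard removes the full complement, which corresponds to the excluded set `T = univ`.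
  rw [h1, Finset.sum_powerset_apply_card (fun j => if S.card + j < K then F (S.card + j) else 0),
    Finset.card_compl, Fintype.card_fin, Finset.sum_range_succ]
  rw [show S.card + (K - S.card) = K by omega]
  simp only [lt_irrefl, if_false, smul_zero, add_zero]
  rw [Finset.sum_Ico_eq_sum_range]
  refine Finset.sum_congr rfl fun j hj => ?_
  have := Finset.mem_range.1 hj
  rw [if_pos (by omega), Nat.add_sub_cancel_left, nsmul_eq_mul]

/-- The identity `binom(K,m) binom(m,s) = binom(K,s) binom(K-s,m-s)` turns the weighted sum over
supersets into the sum in `scaledRisk`, divided by `binom(K,s)`. The weights are chosen for this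
purpose. -/
lemma one_le_sum_supersets {K : ℕ} (S : Finset (Fin K)) (hs : S.card < K) {β : ℝ} (hβ : 0 < β)
    {v x : ℝ} (hx : 0 < x) (hv : x < 1 - v) (h : riskPoly K S.card β v = 0) :
    1 ≤ ∑ T with S ⊆ T ∧ T ≠ Finset.univ,
      β / K / (K.choose T.card) * (x ^ (K - T.card))⁻¹ := by
  rw [sum_supersets_card S (fun m => β / K / (K.choose m) * (x ^ (K - m))⁻¹)]
  have hc : (0 : ℝ) < K.choose S.card := by exact_mod_cast Nat.choose_pos hs.le
  have h0 := scaledRisk_nonpos hs hβ hx hv h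
  rw [scaledRisk, sub_nonpos] at h0
  have h1 : ∀ m ∈ Finset.Ico S.card K, ((K - S.card).choose (m - S.card) : ℝ) *
      (β / K / (K.choose m) * (x ^ (K - m))⁻¹) =
      (β / K) * ((m.choose S.card : ℝ) * (x ^ (K - m))⁻¹) / (K.choose S.card) := by
    intro m hm
    obtain ⟨h1, h2⟩ := Finset.mem_Ico.1 hm
    have hcm : (0 : ℝ) < K.choose m := by exact_mod_cast Nat.choose_pos h2.le
    have he : (K.choose m : ℝ) * m.choose S.card =
        K.choose S.card * (K - S.card).choose (m - S.card) := by
      exact_mod_cast Nat.choose_mul (n := K) h1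
    rw [eq_div_iff hc.ne']
    calc _ = (K.choose S.card * (K - S.card).choose (m - S.card) : ℝ) / K.choose m *
          (β / K * (x ^ (K - m))⁻¹) := by ring
      _ = _ := by
        rw [← he, mul_div_cancel_left₀ _ hcm.ne']
        ring
  rw [Finset.sum_congr rfl h1, ← Finset.sum_div, ← Finset.mul_sum]
  exact (one_le_div hc).2 h0

lemma one_le_sum_supersets_ennreal {K : ℕ} (S : Finset (Fin K)) (hs : S.card < K) {β : ℝ}
    (hβ : 0 < β) {v x : ℝ} (hx : 0 ≤ x) (hv : x < 1 - v) (h : riskPoly K S.card β v = 0) :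
    1 ≤ ∑ T with S ⊆ T ∧ T ≠ Finset.univ,
      ENNReal.ofReal (β / K / (K.choose T.card)) * (ENNReal.ofReal x ^ (K - T.card))⁻¹ := by
  have hK : (0 : ℝ) < K := by exact_mod_cast (Nat.zero_le _).trans_lt hs
  rcases hx.eq_or_lt with rfl | hx
  -- For `x = 0` the term `T = S` is already infinite.
  · have hS : S ∈ Finset.univ.filter fun T => S ⊆ T ∧ T ≠ Finset.univ := by
      simp only [Finset.mem_filter, Finset.mem_univ, true_and, subset_refl, ne_eq]
      rintro rfl
      simp at hs
    refine le_trans ?_ (Finset.single_le_sum (fun _ _ => zero_le) hS)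
    have hc : (0 : ℝ) < K.choose S.card := by exact_mod_cast Nat.choose_pos hs.le
    rw [ENNReal.ofReal_zero, zero_pow (by omega), ENNReal.inv_zero, ENNReal.mul_top]
    · exact le_top
    · simpa using div_pos (div_pos hβ hK) hc
  · have h1 := ENNReal.ofReal_le_ofReal (one_le_sum_supersets S hs hβ hx hv h)
    rw [ENNReal.ofReal_one, ENNReal.ofReal_sum_of_nonneg (fun T _ => by positivity)] at h1
    refine h1.trans (Finset.sum_le_sum fun T _ => ?_)
    rw [ENNReal.ofReal_mul (by positivity), ENNReal.ofReal_inv_of_pos (by positivity),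
      ENNReal.ofReal_pow hx.le]

/-- For each of the `K` sizes `m < K`, the `binom(K,m)` sets of size `m` share the mass `β / K`. For
`K = 0` there is no proper subset. -/
lemma sum_weights_le {K : ℕ} {β : ℝ} (hβ : 0 < β) :
    ∑ T : Finset (Fin K) with T ≠ Finset.univ, ENNReal.ofReal (β / K / (K.choose T.card)) ≤
      ENNReal.ofReal β := by
  rcases Nat.eq_zero_or_pos K with rfl | hK
  · simp
  have hK' : (0 : ℝ) < K := by exact_mod_cast hK
  rw [← ENNReal.ofReal_sum_of_nonneg (fun T _ => by positivity)]
  refine ENNReal.ofReal_le_ofReal (le_of_eq ?_)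
  have h := sum_supersets_card (K := K) ∅ (fun m => β / K / (K.choose m))
  simp only [Finset.empty_subset, true_and, Finset.card_empty, Nat.sub_zero] at h
  rw [h]
  have h1 : ∀ m ∈ Finset.Ico 0 K, (K.choose m : ℝ) * (β / K / (K.choose m)) = β / K := by
    intro m hm
    have hcm : (0 : ℝ) < K.choose m := by
      exact_mod_cast Nat.choose_pos (Finset.mem_Ico.1 hm).2.le
    field_simp
  rw [Finset.sum_congr rfl h1]
  simp
  field_simp

/-! ### Solutions for a part of the sample -/

section

variable {Δ U : Type*} {M : (n : ℕ) → (Fin n → Δ) → U} {ℍ : Δ → Set U} {K : ℕ}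

/-- The result for the scenarios with indices in `S`, listed in increasing order. -/
def subSolution (M : (n : ℕ) → (Fin n → Δ) → U) (S : Finset (Fin K)) (δ : Fin K → Δ) : U :=
  M S.card fun i => δ (S.orderEmbOfFin rfl i)

lemma subSolution_congr {S : Finset (Fin K)} {δ δ' : Fin K → Δ} (h : ∀ i ∈ S, δ i = δ' i) :
    subSolution M S δ = subSolution M S δ' := by
  unfold subSolution
  congr 1
  funext i
  exact h _ (S.orderEmbOfFin_mem rfl i)

lemma apply_perm (hM : ∀ n, 1 ≤ n → ConsistentAt M ℍ n) (n : ℕ) (δ : Fin n → Δ)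
    (σ : Equiv.Perm (Fin n)) : M n (fun i => δ (σ i)) = M n δ := by
  rcases Nat.eq_zero_or_pos n with rfl | hn
  · congr 1
    funext i
    exact i.elim0
  · exact (hM n hn).perm δ σ

/-- The result for the scenarios in `S` does not depend on how they are enumerated. -/
lemma apply_comp_eq_subSolution (hM : ∀ n, 1 ≤ n → ConsistentAt M ℍ n) {n : ℕ}
    {e : Fin n → Fin K} (he : Function.Injective e) {S : Finset (Fin K)}
    (hS : ∀ i, i ∈ S ↔ ∃ j, e j = i) (δ : Fin K → Δ) :
    M n (fun i => δ (e i)) = subSolution M S δ := by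
  have hcard : S.card = n := by
    have : S = Finset.univ.image e := by ext i; simp [hS]
    rw [this, Finset.card_image_of_injective _ he, Finset.card_univ, Fintype.card_fin]
  subst hcard
  have hmem : ∀ j, ∃ k, S.orderEmbOfFin rfl k = e j := by
    intro j
    have h : e j ∈ Set.range (S.orderEmbOfFin rfl) := by
      rw [Finset.range_orderEmbOfFin]
      exact (hS _).2 ⟨j, rfl⟩
    exact h
  choose σ hσ using hmem
  have hinj : Function.Injective σ := fun i j hij => he (by rw [← hσ, ← hσ, hij])
  have h := apply_perm hM S.card (fun i => δ (S.orderEmbOfFin rfl i))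
    (Equiv.ofBijective σ (Finite.injective_iff_bijective.1 hinj))
  simp only [Equiv.ofBijective_apply, hσ] at h
  exact h

lemma subSolution_univ (hM : ∀ n, 1 ≤ n → ConsistentAt M ℍ n) (δ : Fin K → Δ) :
    subSolution M Finset.univ δ = M K δ :=
  (apply_comp_eq_subSolution hM (e := id) Function.injective_id (by simp) δ).symm

/-- Permutation invariance allows `S` to be listed before `T \ S`, the order to which the
consistency axioms apply. -/
lemma apply_append_eq_subSolution (hM : ∀ n, 1 ≤ n → ConsistentAt M ℍ n)
    {S T : Finset (Fin K)} (hST : S ⊆ T) (δ : Fin K → Δ) :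
    M (S.card + (T \ S).card) (Fin.append (fun i => δ (S.orderEmbOfFin rfl i))
      (fun i => δ ((T \ S).orderEmbOfFin rfl i))) = subSolution M T δ := by
  have hS : ∀ j, S.orderEmbOfFin rfl j ∈ S := S.orderEmbOfFin_mem rfl
  have hT : ∀ j, (T \ S).orderEmbOfFin rfl j ∈ T \ S := (T \ S).orderEmbOfFin_mem rfl
  rw [← apply_comp_eq_subSolution hM
    (e := Fin.append (S.orderEmbOfFin rfl) ((T \ S).orderEmbOfFin rfl))]
  · congr 1
    funext i
    refine Fin.addCases (fun j => ?_) (fun j => ?_) i <;> simp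
  · rw [Fin.append_injective_iff]
    refine ⟨(S.orderEmbOfFin rfl).injective, ((T \ S).orderEmbOfFin rfl).injective, ?_⟩
    intro i j h
    exact (Finset.mem_sdiff.1 (hT j)).2 (h ▸ hS i)
  · intro i
    constructor
    · intro hi
      by_cases h : i ∈ S
      · have h' : i ∈ Set.range (S.orderEmbOfFin rfl) := by
          rwa [Finset.range_orderEmbOfFin]
        obtain ⟨j, hj⟩ := h'
        exact ⟨Fin.castAdd _ j, by simpa using hj⟩
      · have h' : i ∈ Set.range ((T \ S).orderEmbOfFin rfl) := by
          rw [Finset.range_orderEmbOfFin]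
          exact Finset.mem_sdiff.2 ⟨hi, h⟩
        obtain ⟨j, hj⟩ := h'
        exact ⟨Fin.natAdd _ j, by simpa using hj⟩
    · rintro ⟨j, rfl⟩
      refine Fin.addCases (fun j => ?_) (fun j => ?_) j
      · simpa using hST (hS j)
      · simpa using (Finset.mem_sdiff.1 (hT j)).1

/-- Enlarging `S` to `T` keeps the result if and only if it suits the scenarios in `T \ S`. -/
lemma subSolution_eq_iff (hM : ∀ n, 1 ≤ n → ConsistentAt M ℍ n) {S T : Finset (Fin K)}
    (hST : S ⊆ T) (hS : ConsistentAt M ℍ S.card) (δ : Fin K → Δ) :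
    subSolution M S δ = subSolution M T δ ↔ ∀ i ∈ T \ S, subSolution M S δ ∈ ℍ (δ i) := by
  have hT : ∀ j, (T \ S).orderEmbOfFin rfl j ∈ T \ S := (T \ S).orderEmbOfFin_mem rfl
  -- The axioms concern at least one additional scenario, so `S = T` is separate.
  rcases Nat.eq_zero_or_pos (T \ S).card with h0 | hpos
  · rw [Finset.card_eq_zero] at h0
    have : S = T := hST.antisymm (Finset.sdiff_eq_empty_iff_subset.1 h0)
    subst this
    simp
  constructor
  · intro h i hi
    by_contra hn
    have hi' : i ∈ Set.range ((T \ S).orderEmbOfFin rfl) := by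
      rwa [Finset.range_orderEmbOfFin]
    obtain ⟨j, rfl⟩ := hi'
    have := hS.responsive _ hpos (fun i => δ (S.orderEmbOfFin rfl i))
      (fun i => δ ((T \ S).orderEmbOfFin rfl i)) ⟨j, hn⟩
    rw [apply_append_eq_subSolution hM hST] at this
    exact this h
  · intro h
    have := hS.stable _ hpos (fun i => δ (S.orderEmbOfFin rfl i))
      (fun i => δ ((T \ S).orderEmbOfFin rfl i)) (fun j => h _ (hT j))
    rwa [apply_append_eq_subSolution hM hST] at this

/-! ### Selection of one support set -/

/-- `S` is a proper subset of the sample which leads to the same result as `T`, and at whose size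
the family `M` is consistent. -/
structure IsCandidate (M : (n : ℕ) → (Fin n → Δ) → U) (ℍ : Δ → Set U) (δ : Fin K → Δ)
    (T S : Finset (Fin K)) : Prop where
  ne_univ : S ≠ Finset.univ
  subset : S ⊆ T
  consistent : ConsistentAt M ℍ S.card
  eq : subSolution M S δ = subSolution M T δ

variable {ι : Type*} [LinearOrder ι]

/-- `S` has the least rank among the candidates for `T`. -/
def IsSelected (M : (n : ℕ) → (Fin n → Δ) → U) (ℍ : Δ → Set U) (r : Finset (Fin K) → ι)
    (δ : Fin K → Δ) (T S : Finset (Fin K)) : Prop :=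
  IsCandidate M ℍ δ T S ∧ ∀ S', IsCandidate M ℍ δ T S' → r S ≤ r S'

variable {r : Finset (Fin K) → ι} {S T : Finset (Fin K)} {δ δ' : Fin K → Δ}

lemma IsSelected.eq (hr : Function.Injective r) {S' : Finset (Fin K)}
    (h : IsSelected M ℍ r δ T S) (h' : IsSelected M ℍ r δ T S') : S = S' :=
  hr ((h.2 _ h'.1).antisymm (h'.2 _ h.1))

lemma IsCandidate.exists_isSelected (r : Finset (Fin K) → ι) (h : IsCandidate M ℍ δ T S) :
    ∃ S', IsSelected M ℍ r δ T S' ∧ r S' ≤ r S := by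
  classical
  obtain ⟨S', hS', hmin⟩ := Finset.exists_min_image
    (Finset.univ.filter fun S' => IsCandidate M ℍ δ T S') r ⟨S, by simpa using h⟩
  simp only [Finset.mem_filter, Finset.mem_univ, true_and] at hS' hmin
  exact ⟨S', ⟨hS', hmin⟩, hmin _ h⟩

lemma IsCandidate.congr (hδ : ∀ i ∈ T, δ i = δ' i) (h : IsCandidate M ℍ δ T S) :
    IsCandidate M ℍ δ' T S where
  ne_univ := h.ne_univ
  subset := h.subset
  consistent := h.consistent
  eq := by
    rw [← subSolution_congr hδ, ← subSolution_congr fun i hi => hδ i (h.subset hi), h.eq]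

lemma IsSelected.congr (hδ : ∀ i ∈ T, δ i = δ' i) (h : IsSelected M ℍ r δ T S) :
    IsSelected M ℍ r δ' T S :=
  ⟨h.1.congr hδ, fun S' h' => h.2 S' (h'.congr fun i hi => (hδ i hi).symm)⟩

/-- All candidates for `T` lie inside `T`, so the selection sees only scenarios in `T`. The
independence argument rests on this. -/
lemma isSelected_congr (hδ : ∀ i ∈ T, δ i = δ' i) :
    IsSelected M ℍ r δ T S ↔ IsSelected M ℍ r δ' T S :=
  ⟨IsSelected.congr hδ, IsSelected.congr fun i hi => (hδ i hi).symm⟩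

lemma IsSelected.suitable (hM : ∀ n, 1 ≤ n → ConsistentAt M ℍ n)
    (h : IsSelected M ℍ r δ Finset.univ S) {i : Fin K} (hi : i ∉ S) :
    subSolution M S δ ∈ ℍ (δ i) :=
  (subSolution_eq_iff hM h.1.subset h.1.consistent δ).1 h.1.eq i (by simpa using hi)

/-- A set selected for the whole sample is also selected for every part which contains it. -/
lemma IsSelected.of_subset (hM : ∀ n, 1 ≤ n → ConsistentAt M ℍ n)
    (h : IsSelected M ℍ r δ Finset.univ S) (hST : S ⊆ T) : IsSelected M ℍ r δ T S := by
  have he : subSolution M S δ = subSolution M T δ :=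
    (subSolution_eq_iff hM hST h.1.consistent δ).2
      fun i hi => h.suitable hM (Finset.mem_sdiff.1 hi).2
  -- A rival candidate for `T` gives the result of `T`, hence that of `S`, hence that of the whole
  -- sample. It was thus already a rival there.
  refine ⟨⟨h.1.ne_univ, hST, h.1.consistent, he⟩, fun S' h' => h.2 S' ?_⟩
  exact ⟨h'.ne_univ, Finset.subset_univ _, h'.consistent, (h'.eq.trans he.symm).trans h.1.eq⟩

end

/-! ### Probabilities -/

section

variable {Δ U : Type*} [MeasurableSpace Δ] [MeasurableSpace U] {K : ℕ}

/-- The sample which has the entries of `δ` at the indices in `T`, and those of `δ'` elsewhere. -/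
def merge (T : Finset (Fin K)) (δ δ' : Fin K → Δ) (i : Fin K) : Δ := if i ∈ T then δ i else δ' i

/-- The preimage of a box is a product of two boxes, in which each index is constrained in exactly
one factor. -/
lemma measurePreserving_merge (μ : Measure Δ) [IsProbabilityMeasure μ] (T : Finset (Fin K)) :
    MeasurePreserving (fun q : (Fin K → Δ) × (Fin K → Δ) => merge T q.1 q.2)
      ((Measure.pi fun _ => μ).prod (Measure.pi fun _ => μ)) (Measure.pi fun _ => μ) := by
  have hm : Measurable (fun q : (Fin K → Δ) × (Fin K → Δ) => merge T q.1 q.2) := by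
    refine measurable_pi_lambda _ fun i => ?_
    unfold merge
    split_ifs <;> fun_prop
  refine ⟨hm, (Measure.pi_eq fun s hs => ?_).symm⟩
  rw [Measure.map_apply hm (MeasurableSet.univ_pi hs)]
  have h : (fun q : (Fin K → Δ) × (Fin K → Δ) => merge T q.1 q.2) ⁻¹' Set.univ.pi s =
      (Set.univ.pi fun i => if i ∈ T then s i else Set.univ) ×ˢ
        (Set.univ.pi fun i => if i ∈ T then Set.univ else s i) := by
    ext q
    simp only [Set.mem_preimage, Set.mem_pi, Set.mem_univ, true_imp_iff, Set.mem_prod, merge,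
      ← forall_and]
    refine forall_congr' fun i => ?_
    split_ifs <;> simp
  rw [h, Measure.prod_prod, Measure.pi_pi, Measure.pi_pi, ← Finset.prod_mul_distrib]
  refine Finset.prod_congr rfl fun i _ => ?_
  split_ifs <;> simp

lemma pi_forall_notMem (μ : Measure Δ) [IsProbabilityMeasure μ] (T : Finset (Fin K))
    (A : Set Δ) :
    (Measure.pi fun _ : Fin K => μ) {δ | ∀ i, i ∉ T → δ i ∈ A} = μ A ^ (K - T.card) := by
  have h : {δ : Fin K → Δ | ∀ i, i ∉ T → δ i ∈ A} =
      Set.univ.pi fun i => if i ∈ T then Set.univ else A := by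
    ext δ
    simp only [Set.mem_ofPred_eq, Set.mem_pi, Set.mem_univ, true_imp_iff]
    refine forall_congr' fun i => ?_
    split_ifs with hi <;> simp [hi]
  have h2 : ∀ i, μ (if i ∈ T then Set.univ else A) = if i ∈ T then 1 else μ A := by
    intro i
    split_ifs <;> simp
  rw [h, Measure.pi_pi, Finset.prod_congr rfl fun i _ => h2 i, Finset.prod_ite]
  simp only [Finset.prod_const_one, one_mul, Finset.prod_const]
  congr 1
  rw [show (Finset.univ.filter fun i => i ∉ T) = Tᶜ by ext; simp, Finset.card_compl,
    Fintype.card_fin]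

variable {ℍ : Δ → Set U}

/-- The scenarios outside `T` are independent of everything determined by the scenarios in `T`. -/
lemma lintegral_mul_suitable (μ : Measure Δ) [IsProbabilityMeasure μ]
    (hℍ : MeasurableSet {p : U × Δ | p.1 ∈ ℍ p.2}) (T : Finset (Fin K))
    {F : (Fin K → Δ) → ENNReal} (hF : Measurable F) {z : (Fin K → Δ) → U} (hz : Measurable z)
    (hFT : ∀ δ δ', (∀ i ∈ T, δ i = δ' i) → F δ = F δ')
    (hzT : ∀ δ δ', (∀ i ∈ T, δ i = δ' i) → z δ = z δ') :
    ∫⁻ δ, F δ * {δ | ∀ i, i ∉ T → z δ ∈ ℍ (δ i)}.indicator 1 δ ∂(Measure.pi fun _ => μ) =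
      ∫⁻ δ, F δ * μ {η | z δ ∈ ℍ η} ^ (K - T.card) ∂(Measure.pi fun _ => μ) := by
  have hset : MeasurableSet {δ : Fin K → Δ | ∀ i, i ∉ T → z δ ∈ ℍ (δ i)} := by
    simp only [Set.ofPred_forall]
    refine MeasurableSet.iInter fun i => MeasurableSet.iInter fun _ => ?_
    exact hℍ.preimage (f := fun δ : Fin K → Δ => (z δ, δ i)) (by fun_prop)
  have hmeas : Measurable fun δ : Fin K → Δ =>
      F δ * {δ | ∀ i, i ∉ T → z δ ∈ ℍ (δ i)}.indicator (1 : (Fin K → Δ) → ENNReal) δ :=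
    hF.mul (measurable_one.indicator hset)
  have hmerge := measurePreserving_merge μ T
  -- The sample is replaced by a merge of two independent ones: `F` and `z` see only the first, the
  -- scenarios outside `T` come from the second.
  rw [← hmerge.lintegral_comp hmeas]
  refine (lintegral_prod _ (hmeas.comp hmerge.measurable).aemeasurable).trans ?_
  refine lintegral_congr fun δ => ?_
  simp only [Function.comp_apply]
  have hagree : ∀ δ', ∀ i ∈ T, merge T δ δ' i = δ i := fun δ' i hi => by simp [merge, hi]
  have h1 : ∀ δ', F (merge T δ δ') *
      {δ | ∀ i, i ∉ T → z δ ∈ ℍ (δ i)}.indicator (1 : (Fin K → Δ) → ENNReal) (merge T δ δ') =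
      F δ * {δ' | ∀ i, i ∉ T → δ' i ∈ {η | z δ ∈ ℍ η}}.indicator 1 δ' := by
    intro δ'
    rw [hFT _ _ (hagree δ')]
    congr 1
    simp only [Set.indicator, Set.mem_ofPred_eq, hzT _ _ (hagree δ'), Pi.one_apply]
    congr 1
    refine propext (forall_congr' fun i => ?_)
    have hzδ := hzT _ _ (hagree δ')
    by_cases hi : i ∈ T <;> simp [hi, hzδ, merge]
  have hA : MeasurableSet {η | z δ ∈ ℍ η} :=
    hℍ.preimage (f := fun η => (z δ, η)) (by fun_prop)
  have hset' : MeasurableSet {δ' : Fin K → Δ | ∀ i, i ∉ T → δ' i ∈ {η | z δ ∈ ℍ η}} := by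
    simp only [Set.ofPred_forall]
    exact MeasurableSet.iInter fun i => MeasurableSet.iInter fun _ =>
      hA.preimage (measurable_pi_apply i)
  simp only [h1]
  rw [lintegral_const_mul _ (measurable_one.indicator hset'), lintegral_indicator_one hset',
    pi_forall_notMem]

variable {M : (n : ℕ) → (Fin n → Δ) → U}

lemma measurable_subSolution (hMm : ∀ n, Measurable (M n)) (S : Finset (Fin K)) :
    Measurable (subSolution M S) := by
  unfold subSolution
  exact (hMm _).comp (measurable_pi_lambda _ fun i => measurable_pi_apply _)

lemma measurable_measure_suitable (μ : Measure Δ) [IsProbabilityMeasure μ]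
    (hℍ : MeasurableSet {p : U × Δ | p.1 ∈ ℍ p.2}) : Measurable fun u => μ {η | u ∈ ℍ η} :=
  measurable_measure_prodMk_left hℍ

variable [MeasurableEq U] {ι : Type*} [LinearOrder ι] {r : Finset (Fin K) → ι}

lemma measurableSet_isCandidate (hMm : ∀ n, Measurable (M n)) (T S : Finset (Fin K)) :
    MeasurableSet {δ | IsCandidate M ℍ δ T S} := by
  -- These three conditions do not involve the sample, so the set is an equalizer or empty.
  by_cases h : S ≠ Finset.univ ∧ S ⊆ T ∧ ConsistentAt M ℍ S.card
  · have he : {δ | IsCandidate M ℍ δ T S} = {δ | subSolution M S δ = subSolution M T δ} :=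
      Set.ext fun δ => ⟨fun h' => h'.eq, fun h' => ⟨h.1, h.2.1, h.2.2, h'⟩⟩
    rw [he]
    exact measurableSet_eq_fun (measurable_subSolution hMm S) (measurable_subSolution hMm T)
  · rw [Set.eq_empty_of_forall_notMem (s := {δ | IsCandidate M ℍ δ T S})
      fun δ h' => h ⟨h'.ne_univ, h'.subset, h'.consistent⟩]
    exact MeasurableSet.empty

lemma measurableSet_isSelected (hMm : ∀ n, Measurable (M n)) (T S : Finset (Fin K)) :
    MeasurableSet {δ | IsSelected M ℍ r δ T S} := by
  refine (measurableSet_isCandidate hMm T S).inter ?_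
  change MeasurableSet {δ | ∀ S', IsCandidate M ℍ δ T S' → r S ≤ r S'}
  rw [Set.ofPred_forall]
  refine MeasurableSet.iInter fun S' => ?_
  by_cases h : r S ≤ r S'
  · simp [h]
  · simp only [h, imp_false]
    exact (measurableSet_isCandidate hMm T S').compl

/-- The sets of samples for which a given set is selected are disjoint. -/
lemma sum_measure_isSelected_le_one (μ : Measure Δ) [IsProbabilityMeasure μ]
    (hMm : ∀ n, Measurable (M n)) (hr : Function.Injective r) (T : Finset (Fin K)) :
    ∑ S, (Measure.pi fun _ => μ) {δ | IsSelected M ℍ r δ T S} ≤ 1 := by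
  rw [← measure_biUnion_finset _ fun S _ => measurableSet_isSelected hMm T S]
  · exact prob_le_one
  · intro S _ S' _ hne
    exact Set.disjoint_left.2 fun δ h h' => hne (IsSelected.eq hr h h')

/-- Passing from the whole sample to a part `T` which contains the selected set gains the
factor `p ^ (K - |T|)`, where `p` is the probability that the result suits a new scenario. -/
lemma setLIntegral_isSelected_le (μ : Measure Δ) [IsProbabilityMeasure μ]
    (hMm : ∀ n, Measurable (M n)) (hℍ : MeasurableSet {p : U × Δ | p.1 ∈ ℍ p.2})
    (hM : ∀ n, 1 ≤ n → ConsistentAt M ℍ n) {S T : Finset (Fin K)} (hST : S ⊆ T) :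
    ∫⁻ δ in {δ | IsSelected M ℍ r δ Finset.univ S},
        (μ {η | subSolution M S δ ∈ ℍ η} ^ (K - T.card))⁻¹ ∂(Measure.pi fun _ => μ) ≤
      (Measure.pi fun _ => μ) {δ | IsSelected M ℍ r δ T S} := by
  set z : (Fin K → Δ) → U := subSolution M S with hzdef
  have hz : Measurable z := measurable_subSolution hMm S
  have hp : Measurable fun δ => μ {η | z δ ∈ ℍ η} ^ (K - T.card) :=
    ((measurable_measure_suitable μ hℍ).comp hz).pow_const _
  have hzT : ∀ δ δ' : Fin K → Δ, (∀ i ∈ T, δ i = δ' i) → z δ = z δ' :=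
    fun δ δ' h => subSolution_congr fun i hi => h i (hST hi)
  have hCm : MeasurableSet {δ | IsSelected M ℍ r δ T S} := measurableSet_isSelected hMm T S
  set F : (Fin K → Δ) → ENNReal := fun δ =>
    {δ | IsSelected M ℍ r δ T S}.indicator 1 δ * (μ {η | z δ ∈ ℍ η} ^ (K - T.card))⁻¹ with hFdef
  have hF : Measurable F := (measurable_one.indicator hCm).mul hp.inv
  have hFT : ∀ δ δ', (∀ i ∈ T, δ i = δ' i) → F δ = F δ' := by
    intro δ δ' h
    have hi : δ ∈ {δ | IsSelected M ℍ r δ T S} ↔ δ' ∈ {δ | IsSelected M ℍ r δ T S} :=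
      isSelected_congr h
    by_cases h' : δ' ∈ {δ | IsSelected M ℍ r δ T S}
    · simp only [hFdef, Set.indicator_of_mem (hi.2 h'), Set.indicator_of_mem h', hzT δ δ' h,
        Pi.one_apply]
    · simp only [hFdef, Set.indicator_of_notMem (mt hi.1 h'), Set.indicator_of_notMem h', zero_mul]
  rw [← lintegral_indicator (measurableSet_isSelected hMm Finset.univ S)]
  calc _ ≤ ∫⁻ δ, F δ * {δ | ∀ i, i ∉ T → z δ ∈ ℍ (δ i)}.indicator 1 δ
          ∂(Measure.pi fun _ => μ) := by
        refine lintegral_mono fun δ => ?_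
        by_cases hδ : δ ∈ {δ | IsSelected M ℍ r δ Finset.univ S}
        swap
        · simp only [Set.indicator_of_notMem hδ, zero_le]
        rw [Set.indicator_of_mem hδ]
        have h1 : δ ∈ {δ | IsSelected M ℍ r δ T S} := IsSelected.of_subset hM hδ hST
        have h2 : δ ∈ {δ | ∀ i, i ∉ T → z δ ∈ ℍ (δ i)} :=
          fun i hi => IsSelected.suitable hM hδ fun h => hi (hST h)
        simp only [hFdef, Set.indicator_of_mem h1, Set.indicator_of_mem h2, Pi.one_apply,
          one_mul, mul_one, le_refl]
    _ = ∫⁻ δ, F δ * μ {η | z δ ∈ ℍ η} ^ (K - T.card) ∂(Measure.pi fun _ => μ) :=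
        lintegral_mul_suitable μ hℍ T hF hz hFT hzT
    _ ≤ ∫⁻ δ, {δ | IsSelected M ℍ r δ T S}.indicator 1 δ ∂(Measure.pi fun _ => μ) := by
        refine lintegral_mono fun δ => ?_
        simp only [hFdef]
        rw [mul_assoc, mul_comm (_⁻¹)]
        -- The inequality also covers a vanishing power, where the product is `0 * ∞ = 0`.
        exact mul_le_of_le_one_right' (ENNReal.mul_inv_le_one _)
    _ = _ := lintegral_indicator_one hCm

/-- The samples for which the selected set `S` leads to a result whose probability of violation
is larger than `ε |S|`. -/
def badSet (M : (n : ℕ) → (Fin n → Δ) → U) (ℍ : Δ → Set U) (r : Finset (Fin K) → ι)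
    (μ : Measure Δ) (ε : ℕ → ℝ) (S : Finset (Fin K)) : Set (Fin K → Δ) :=
  {δ | IsSelected M ℍ r δ Finset.univ S ∧
    μ {η | subSolution M S δ ∈ ℍ η} < ENNReal.ofReal (1 - ε S.card)}

/-- A weighted Markov inequality: on the bad set the sum over supersets is at least one, and its
integral over the whole selection event is controlled term by term. -/
lemma measure_badSet_le (μ : Measure Δ) [IsProbabilityMeasure μ]
    (hMm : ∀ n, Measurable (M n)) (hℍ : MeasurableSet {p : U × Δ | p.1 ∈ ℍ p.2})
    (hM : ∀ n, 1 ≤ n → ConsistentAt M ℍ n) {β : ℝ} (hβ : 0 < β) {ε : ℕ → ℝ}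
    (hε : ∀ s < K, riskPoly K s β (ε s) = 0) (S : Finset (Fin K)) :
    (Measure.pi fun _ => μ) (badSet M ℍ r μ ε S) ≤
      ∑ T with S ⊆ T ∧ T ≠ Finset.univ, ENNReal.ofReal (β / K / (K.choose T.card)) *
        (Measure.pi fun _ => μ) {δ | IsSelected M ℍ r δ T S} := by
  have hp : Measurable fun δ => μ {η | subSolution M S δ ∈ ℍ η} :=
    (measurable_measure_suitable μ hℍ).comp (measurable_subSolution hMm S)
  have hB : MeasurableSet (badSet M ℍ r μ ε S) :=
    (measurableSet_isSelected hMm Finset.univ S).inter (measurableSet_lt hp measurable_const)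
  calc (Measure.pi fun _ => μ) (badSet M ℍ r μ ε S)
      = ∫⁻ δ in badSet M ℍ r μ ε S, 1 ∂(Measure.pi fun _ => μ) := by simp
    _ ≤ ∫⁻ δ in badSet M ℍ r μ ε S, ∑ T with S ⊆ T ∧ T ≠ Finset.univ,
          ENNReal.ofReal (β / K / (K.choose T.card)) *
            (μ {η | subSolution M S δ ∈ ℍ η} ^ (K - T.card))⁻¹ ∂(Measure.pi fun _ => μ) := by
        refine setLIntegral_mono' hB fun δ hδ => ?_
        have hs : S.card < K := by
          simpa using Finset.card_lt_card (Finset.ssubset_univ_iff.2 hδ.1.1.ne_univ)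
        have hlt := hδ.2
        rw [← ofReal_measureReal] at hlt ⊢
        exact one_le_sum_supersets_ennreal S hs hβ measureReal_nonneg
          ((ENNReal.ofReal_lt_ofReal_iff_of_nonneg measureReal_nonneg).1 hlt) (hε _ hs)
    _ ≤ ∫⁻ δ in {δ | IsSelected M ℍ r δ Finset.univ S}, ∑ T with S ⊆ T ∧ T ≠ Finset.univ,
          ENNReal.ofReal (β / K / (K.choose T.card)) *
            (μ {η | subSolution M S δ ∈ ℍ η} ^ (K - T.card))⁻¹ ∂(Measure.pi fun _ => μ) :=
        lintegral_mono_set fun δ hδ => hδ.1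
    _ = ∑ T with S ⊆ T ∧ T ≠ Finset.univ, ENNReal.ofReal (β / K / (K.choose T.card)) *
          ∫⁻ δ in {δ | IsSelected M ℍ r δ Finset.univ S},
            (μ {η | subSolution M S δ ∈ ℍ η} ^ (K - T.card))⁻¹ ∂(Measure.pi fun _ => μ) := by
        rw [lintegral_finsetSum _ fun T _ =>
          Measurable.const_mul (f := fun δ => (μ {η | subSolution M S δ ∈ ℍ η} ^ (K - T.card))⁻¹)
            (hp.pow_const _).inv _]
        exact Finset.sum_congr rfl fun T _ => lintegral_const_mul _ (hp.pow_const _).inv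
    _ ≤ _ := by
        refine Finset.sum_le_sum fun T hT => mul_le_mul_right ?_ _
        exact setLIntegral_isSelected_le μ hMm hℍ hM (Finset.mem_filter.1 hT).2.1

lemma measure_iUnion_badSet_le (μ : Measure Δ) [IsProbabilityMeasure μ]
    (hMm : ∀ n, Measurable (M n)) (hℍ : MeasurableSet {p : U × Δ | p.1 ∈ ℍ p.2})
    (hM : ∀ n, 1 ≤ n → ConsistentAt M ℍ n) (hr : Function.Injective r) {β : ℝ} (hβ : 0 < β)
    {ε : ℕ → ℝ} (hε : ∀ s < K, riskPoly K s β (ε s) = 0) :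
    (Measure.pi fun _ => μ) (⋃ S, badSet M ℍ r μ ε S) ≤ ENNReal.ofReal β := by
  calc (Measure.pi fun _ => μ) (⋃ S, badSet M ℍ r μ ε S)
      ≤ ∑ S, (Measure.pi fun _ => μ) (badSet M ℍ r μ ε S) := measure_iUnion_fintype_le _ _
    _ ≤ ∑ S, ∑ T with S ⊆ T ∧ T ≠ Finset.univ, ENNReal.ofReal (β / K / (K.choose T.card)) *
          (Measure.pi fun _ => μ) {δ | IsSelected M ℍ r δ T S} :=
        Finset.sum_le_sum fun S _ => measure_badSet_le μ hMm hℍ hM hβ hε S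
    -- Dropping `S ⊆ T` allows the sums to be exchanged; for each `T`, disjointness then bounds the
    -- sum over all `S`.
    _ ≤ ∑ S, ∑ T with T ≠ Finset.univ, ENNReal.ofReal (β / K / (K.choose T.card)) *
          (Measure.pi fun _ => μ) {δ | IsSelected M ℍ r δ T S} := by
        refine Finset.sum_le_sum fun S _ => Finset.sum_le_sum_of_subset ?_
        exact Finset.monotone_filter_right _ fun T _ h => h.2
    _ = ∑ T with T ≠ Finset.univ, ENNReal.ofReal (β / K / (K.choose T.card)) *
          ∑ S, (Measure.pi fun _ => μ) {δ | IsSelected M ℍ r δ T S} := by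
        rw [Finset.sum_comm]
        simp only [Finset.mul_sum]
    _ ≤ ∑ T : Finset (Fin K) with T ≠ Finset.univ,
          ENNReal.ofReal (β / K / (K.choose T.card)) :=
        Finset.sum_le_sum fun T _ =>
          mul_le_of_le_one_right' (sum_measure_isSelected_le_one μ hMm hr T)
    _ ≤ ENNReal.ofReal β := sum_weights_le hβ

/-- With probability at least `1 - β`, the probability of violation is at most `ε |S|` for all
support sets `S`. -/
theorem exists_measure_compl_violation_le (μ : Measure Δ) [IsProbabilityMeasure μ]
    (hMm : ∀ n, Measurable (M n)) (hℍ : MeasurableSet {p : U × Δ | p.1 ∈ ℍ p.2})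
    (hM : ∀ n, 1 ≤ n → ConsistentAt M ℍ n) {β : ℝ} (hβ : 0 < β)
    {ε : ℕ → ℝ} (hε : ∀ s < K, riskPoly K s β (ε s) = 0) :
    ∃ B : Set (Fin K → Δ), MeasurableSet B ∧
      (Measure.pi fun _ => μ) B ≤ ENNReal.ofReal β ∧
      ∀ δ ∉ B, ∀ S : Finset (Fin K), S.card < K → IsSupportSet M δ S →
        (S = ∅ → ConsistentAt M ℍ 0) → μ.real {η | M K δ ∉ ℍ η} ≤ ε S.card := by
  -- The first component makes the selected set the one with the smallest risk level, without any
  -- monotonicity of `ε`; the enumeration only breaks ties.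
  let r : Finset (Fin K) → ℝ ×ₗ Fin (Fintype.card (Finset (Fin K))) :=
    fun S => toLex (ε S.card, Fintype.equivFin _ S)
  have hr : Function.Injective r := by
    intro S S' h
    have := congrArg (fun x => (ofLex x).2) h
    exact (Fintype.equivFin (Finset (Fin K))).injective this
  have hp : ∀ S : Finset (Fin K), Measurable fun δ => μ {η | subSolution M S δ ∈ ℍ η} :=
    fun S => (measurable_measure_suitable μ hℍ).comp (measurable_subSolution hMm S)
  refine ⟨⋃ S, badSet M ℍ r μ ε S, MeasurableSet.iUnion fun S => ?_,
    measure_iUnion_badSet_le μ hMm hℍ hM hr hβ hε, fun δ hδ S hS hsupp h0 => ?_⟩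
  · exact (measurableSet_isSelected hMm Finset.univ S).inter
      (measurableSet_lt (hp S) measurable_const)
  have hcand : IsCandidate M ℍ δ Finset.univ S := by
    refine ⟨?_, Finset.subset_univ S, ?_, ?_⟩
    · rintro rfl
      simp at hS
    · rcases S.eq_empty_or_nonempty with rfl | hne
      · exact h0 rfl
      · exact hM _ hne.card_pos
    · exact Eq.trans hsupp (subSolution_univ hM δ).symm
  obtain ⟨S', hS', hle⟩ := hcand.exists_isSelected r
  have hle : ε S'.card ≤ ε S.card := by
    rcases Prod.Lex.le_iff.1 hle with h | h
    · exact h.le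
    · exact h.1.le
  refine le_trans ?_ hle
  have hn : ¬ μ {η | subSolution M S' δ ∈ ℍ η} < ENNReal.ofReal (1 - ε S'.card) :=
    fun h => hδ (Set.mem_iUnion.2 ⟨S', hS', h⟩)
  rw [hS'.1.eq, subSolution_univ hM, not_lt, ENNReal.ofReal_le_iff_le_toReal (measure_ne_top _ _)]
    at hn
  have hA : MeasurableSet {η | M K δ ∈ ℍ η} :=
    hℍ.preimage (f := fun η => (M K δ, η)) (by fun_prop)
  have hc := probReal_compl_eq_one_sub (μ := μ) hA
  have : {η | M K δ ∉ ℍ η} = {η | M K δ ∈ ℍ η}ᶜ := rfl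
  rw [this, hc]
  simp only [Measure.real]
  linarith

end

/-! ### The generated scenarios have the conditional law of the actual scenario -/

section

lemma measurable_finSnoc {X α : Type*} [MeasurableSpace X] [MeasurableSpace α] {n : ℕ}
    {f : X → Fin n → α} {a : X → α} (hf : Measurable f) (ha : Measurable a) :
    Measurable fun x => (Fin.snoc (α := fun _ => α) (f x) (a x) : Fin (n + 1) → α) := by
  refine measurable_pi_lambda _ fun i => ?_
  refine Fin.lastCases ?_ (fun j => ?_) i
  · simpa using ha
  · simp only [Fin.snoc_castSucc]
    exact (measurable_pi_apply j).comp hf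

lemma measurable_finInit {α : Type*} [MeasurableSpace α] {n : ℕ} :
    Measurable fun v : Fin (n + 1) → α => (Fin.init v : Fin n → α) :=
  measurable_pi_lambda _ fun i => measurable_pi_apply i.castSucc

/-- Integration over `n + 1` i.i.d. variables, with the last one separated. -/
lemma lintegral_pi_eq_lintegral_snoc {α : Type*} [MeasurableSpace α] (ν : Measure α)
    [IsProbabilityMeasure ν] (n : ℕ) {f : (Fin (n + 1) → α) → ENNReal} (hf : Measurable f) :
    ∫⁻ v, f v ∂(Measure.pi fun _ => ν) =
      ∫⁻ v, ∫⁻ a, f (Fin.snoc (α := fun _ => α) v a) ∂ν ∂(Measure.pi fun _ => ν) := by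
  have h := (measurePreserving_piFinSuccAbove (fun _ : Fin (n + 1) => ν) (Fin.last n)).symm
  rw [← h.lintegral_comp hf]
  refine (lintegral_prod_symm' _ (hf.comp h.measurable)).trans ?_
  refine lintegral_congr fun v => lintegral_congr fun a => ?_
  simp [MeasurableEquiv.piFinSuccAbove, Fin.insertNthEquiv, Fin.insertNth_last']

variable {nθ nx nu ny : ℕ} {R : Type*} [MeasurableSpace R] (𝔖 : Setting nθ nx nu ny R) (L H : ℕ)

@[fun_prop]
lemma Model.measurable_transition (𝔐 : Model nθ nx nu ny) {X : Type*} [MeasurableSpace X]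
    {a : X → Vec nθ} {b : X → Vec nx} {c : X → Vec nu} (ha : Measurable a) (hb : Measurable b)
    (hc : Measurable c) : Measurable fun x => 𝔐.f (a x) (b x) (c x) :=
  𝔐.measurable_f.comp (ha.prodMk (hb.prodMk hc))

@[fun_prop]
lemma Model.measurable_observation (𝔐 : Model nθ nx nu ny) {X : Type*} [MeasurableSpace X]
    {a : X → Vec nθ} {b : X → Vec nx} {c : X → Vec nu} (ha : Measurable a) (hb : Measurable b)
    (hc : Measurable c) : Measurable fun x => 𝔐.g (a x) (b x) (c x) :=
  𝔐.measurable_g.comp (ha.prodMk (hb.prodMk hc))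

lemma Setting.measurable_run (n : ℕ) :
    Measurable fun p : Vec nθ × Vec nx × R × (Fin n → Vec nx) × (Fin n → Vec ny) =>
      𝔖.run p.1 p.2.1 p.2.2.1 n p.2.2.2.1 p.2.2.2.2 := by
  induction n with
  | zero =>
    simp only [Setting.run]
    fun_prop
  | succ n ih =>
    have hpast : Measurable fun p : Vec nθ × Vec nx × R × (Fin (n + 1) → Vec nx) ×
        (Fin (n + 1) → Vec ny) =>
        𝔖.run p.1 p.2.1 p.2.2.1 n (Fin.init p.2.2.2.1) (Fin.init p.2.2.2.2) := by
      have hv := (measurable_finInit (α := Vec nx) (n := n))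
      have hw := (measurable_finInit (α := Vec ny) (n := n))
      have hin : Measurable fun p : Vec nθ × Vec nx × R × (Fin (n + 1) → Vec nx) ×
          (Fin (n + 1) → Vec ny) => ((p.1, p.2.1, p.2.2.1, Fin.init p.2.2.2.1,
            Fin.init p.2.2.2.2) :
          Vec nθ × Vec nx × R × (Fin n → Vec nx) × (Fin n → Vec ny)) := by fun_prop
      exact ih.comp hin
    have hx := (measurable_pi_apply (Fin.last n)).comp hpast.snd
    have hu := (𝔖.measurable_input n).comp
      ((measurable_fst.comp (measurable_snd.comp measurable_snd)).prodMk hpast.fst)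
    simp only [Function.comp_def] at hx hu
    simp only [Setting.run]
    refine Measurable.prodMk (measurable_finSnoc hpast.fst (hu.prodMk ?_))
      (measurable_finSnoc hpast.snd ?_) <;> fun_prop

/-- What determines the data set and the latent variables: the parameters, the initial state, the
exogenous randomness, the process noise before time `-1`, and the past measurement noise. -/
abbrev PastSource (nθ nx ny : ℕ) (R : Type*) (L : ℕ) : Type _ :=
  Vec nθ × Vec nx × R × (Fin L → Vec nx) × (Fin (L + 1) → Vec ny)

/-- Process noise at time `-1` and future noise. -/
abbrev FreshNoise (nx ny H : ℕ) : Type :=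
  Vec nx × (Fin (H + 1) → Vec nx) × (Fin (H + 1) → Vec ny)

/-- The data set and the latent variables, as functions of what determines them. -/
def Setting.observe (q : PastSource nθ nx ny R L) :
    Data nu ny L × (Vec nθ × (Fin (L + 1) → Vec nx)) :=
  let past := 𝔖.run q.1 q.2.1 q.2.2.1 L q.2.2.2.1 (Fin.init q.2.2.2.2)
  let x := past.2 (Fin.last L)
  let u := 𝔖.input L q.2.2.1 past.1
  (Fin.snoc (α := fun _ => Vec nu × Vec ny) past.1
    (u, 𝔖.g q.1 x u + q.2.2.2.2 (Fin.last L)), q.1, past.2)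

/-- The scenario which results from the data set, the latent variables and fresh noise. -/
def Setting.assemble
    (p : Data nu ny L × (Vec nθ × (Fin (L + 1) → Vec nx)) × FreshNoise nx ny H) :
    Scenario nθ nx ny H :=
  (p.2.1.1, 𝔖.f p.2.1.1 (p.2.1.2 (Fin.last L)) (p.1 (Fin.last L)).1 + p.2.2.1,
    p.2.2.2.1, p.2.2.2.2)

/-- The law of the process noise at time `-1` and of the future noise, given the parameters. -/
def Setting.freshNoise : Kernel (Vec nθ) (FreshNoise nx ny H) :=
  𝔖.procNoise ×ₖ (iidKernel 𝔖.procNoise (H + 1) ×ₖ iidKernel 𝔖.measNoise (H + 1))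

instance : IsMarkovKernel (𝔖.freshNoise H) := by
  unfold Setting.freshNoise
  infer_instance

variable {L H}

/-- The part of the random elements that determines the data set and the latent variables. -/
def Truth.pastSource (τ : Truth nθ nx ny R L H) : PastSource nθ nx ny R L :=
  (τ.1, τ.2.1, τ.2.2.1, Fin.init τ.2.2.2.1, τ.2.2.2.2.1)

/-- The remaining random elements. -/
def Truth.fresh (τ : Truth nθ nx ny R L H) : FreshNoise nx ny H :=
  (τ.2.2.2.1 (Fin.last L), τ.2.2.2.2.2.1, τ.2.2.2.2.2.2)

lemma Truth.measurable_pastSource :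
    Measurable (Truth.pastSource (nθ := nθ) (nx := nx) (ny := ny) (R := R) (L := L) (H := H)) := by
  have hv := (measurable_finInit (α := Vec nx) (n := L))
  unfold Truth.pastSource
  fun_prop

lemma Truth.measurable_fresh :
    Measurable (Truth.fresh (nθ := nθ) (nx := nx) (ny := ny) (R := R) (L := L) (H := H)) := by
  unfold Truth.fresh
  fun_prop

/-- The noise `v_{-1}` enters only the state at time `0`, which the latent trajectory omits, and no
past output. -/
lemma Setting.observe_pastSource (τ : Truth nθ nx ny R L H) :
    𝔖.observe L (Truth.pastSource τ) = (𝔖.dataOf τ, 𝔖.latentOf τ) := by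
  simp [Setting.observe, Truth.pastSource, Setting.dataOf, Setting.latentOf, Setting.pastOf,
    Setting.run]

lemma Setting.trueScenarioOf_eq (τ : Truth nθ nx ny R L H) :
    𝔖.trueScenarioOf τ =
      𝔖.assemble L H (𝔖.dataOf τ, 𝔖.latentOf τ, Truth.fresh τ) := by
  simp [Setting.assemble, Truth.fresh, Setting.dataOf, Setting.latentOf, Setting.pastOf,
    Setting.run, Setting.trueScenarioOf]

lemma Setting.measurable_observe : Measurable (𝔖.observe L) := by
  have hpast : Measurable fun q : PastSource nθ nx ny R L =>
      𝔖.run q.1 q.2.1 q.2.2.1 L q.2.2.2.1 (Fin.init q.2.2.2.2) := by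
    have hw := (measurable_finInit (α := Vec ny) (n := L))
    have hin : Measurable fun q : PastSource nθ nx ny R L => ((q.1, q.2.1, q.2.2.1, q.2.2.2.1,
        Fin.init q.2.2.2.2) :
        Vec nθ × Vec nx × R × (Fin L → Vec nx) × (Fin L → Vec ny)) := by fun_prop
    exact (𝔖.measurable_run L).comp hin
  have hx := (measurable_pi_apply (Fin.last L)).comp hpast.snd
  have hu := (𝔖.measurable_input L).comp
    ((measurable_fst.comp (measurable_snd.comp measurable_snd)).prodMk hpast.fst)
  simp only [Function.comp_def] at hx hu
  unfold Setting.observe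
  refine (measurable_finSnoc hpast.fst (hu.prodMk ?_)).prodMk (measurable_fst.prodMk hpast.snd)
  fun_prop

lemma Setting.measurable_dataOf_latentOf :
    Measurable fun τ : Truth nθ nx ny R L H => (𝔖.dataOf τ, 𝔖.latentOf τ) := by
  simp only [← 𝔖.observe_pastSource]
  exact 𝔖.measurable_observe.comp Truth.measurable_pastSource

lemma Setting.measurable_assemble : Measurable (𝔖.assemble L H) := by
  unfold Setting.assemble
  fun_prop

lemma Setting.measurable_trueScenarioOf :
    Measurable (𝔖.trueScenarioOf : Truth nθ nx ny R L H → Scenario nθ nx ny H) := by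
  have h : (𝔖.trueScenarioOf : Truth nθ nx ny R L H → Scenario nθ nx ny H) = fun τ =>
      𝔖.assemble L H ((𝔖.dataOf τ, 𝔖.latentOf τ).1, (𝔖.dataOf τ, 𝔖.latentOf τ).2,
        Truth.fresh τ) := funext 𝔖.trueScenarioOf_eq
  rw [h]
  have h1 := 𝔖.measurable_dataOf_latentOf (L := L) (H := H)
  exact 𝔖.measurable_assemble.comp (h1.fst.prodMk (h1.snd.prodMk Truth.measurable_fresh))

lemma Setting.lintegral_truthLaw {f : Truth nθ nx ny R L H → ENNReal} (hf : Measurable f) :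
    ∫⁻ τ, f τ ∂(𝔖.truthLaw L H) = ∫⁻ θ, ∫⁻ x, ∫⁻ r, ∫⁻ v, ∫⁻ w, ∫⁻ v', ∫⁻ w',
      f (θ, x, r, v, w, v', w') ∂(iidKernel 𝔖.measNoise (H + 1) θ)
        ∂(iidKernel 𝔖.procNoise (H + 1) θ) ∂(iidKernel 𝔖.measNoise (L + 1) θ)
        ∂(iidKernel 𝔖.procNoise (L + 1) θ) ∂𝔖.exo ∂𝔖.priorState ∂𝔖.priorParam := by
  rw [Setting.truthLaw, Measure.lintegral_compProd hf]
  refine lintegral_congr fun θ => ?_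
  rw [Kernel.lintegral_prod _ _ _ (by fun_prop), Kernel.const_apply]
  refine lintegral_congr fun x => ?_
  rw [Kernel.lintegral_prod _ _ _ (by fun_prop), Kernel.const_apply]
  refine lintegral_congr fun r => ?_
  rw [Kernel.lintegral_prod _ _ _ (by fun_prop)]
  refine lintegral_congr fun v => ?_
  rw [Kernel.lintegral_prod _ _ _ (by fun_prop)]
  refine lintegral_congr fun w => ?_
  rw [Kernel.lintegral_prod _ _ _ (by fun_prop)]

/-- Given the parameters, the fresh noise is independent of everything that determines the data
set and the latent variables. -/
lemma Setting.lintegral_truthLaw_pastSource_fresh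
    {f : PastSource nθ nx ny R L × FreshNoise nx ny H → ENNReal} (hf : Measurable f) :
    ∫⁻ τ, f (Truth.pastSource τ, Truth.fresh τ) ∂(𝔖.truthLaw L H) =
      ∫⁻ θ, ∫⁻ x, ∫⁻ r, ∫⁻ v, ∫⁻ w, ∫⁻ n, f ((θ, x, r, v, w), n) ∂(𝔖.freshNoise H θ)
        ∂(iidKernel 𝔖.measNoise (L + 1) θ)
        ∂(Measure.pi fun _ => 𝔖.procNoise θ) ∂𝔖.exo ∂𝔖.priorState ∂𝔖.priorParam := by
  refine (𝔖.lintegral_truthLaw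
    (hf.comp (Truth.measurable_pastSource.prodMk Truth.measurable_fresh))).trans ?_
  refine lintegral_congr fun θ => lintegral_congr fun x => lintegral_congr fun r => ?_
  simp only [Function.comp_apply, Truth.pastSource, Truth.fresh]
  have hinit := (measurable_finInit (α := Vec nx) (n := L))
  -- This separates `v_{-1}` from the earlier process noise.
  rw [show iidKernel 𝔖.procNoise (L + 1) θ = Measure.pi fun _ => 𝔖.procNoise θ from rfl,
    lintegral_pi_eq_lintegral_snoc]
  swap
  · refine Measurable.lintegral_prod_right' (f := fun p : (Fin (L + 1) → Vec nx) ×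
      (Fin (L + 1) → Vec ny) => ∫⁻ v', ∫⁻ w', f ((θ, x, r, Fin.init p.1, p.2),
        p.1 (Fin.last L), v', w') ∂(iidKernel 𝔖.measNoise (H + 1) θ)
        ∂(iidKernel 𝔖.procNoise (H + 1) θ)) ?_
    refine Measurable.lintegral_prod_right' (f := fun p : ((Fin (L + 1) → Vec nx) ×
      (Fin (L + 1) → Vec ny)) × (Fin (H + 1) → Vec nx) => ∫⁻ w', f ((θ, x, r, Fin.init p.1.1,
        p.1.2), p.1.1 (Fin.last L), p.2, w') ∂(iidKernel 𝔖.measNoise (H + 1) θ)) ?_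
    refine Measurable.lintegral_prod_right' (f := fun p : (((Fin (L + 1) → Vec nx) ×
      (Fin (L + 1) → Vec ny)) × (Fin (H + 1) → Vec nx)) × (Fin (H + 1) → Vec ny) =>
      f ((θ, x, r, Fin.init p.1.1.1, p.1.1.2), p.1.1.1 (Fin.last L), p.1.2, p.2)) ?_
    fun_prop
  refine lintegral_congr fun v => ?_
  simp only [Fin.init_snoc, Fin.snoc_last]
  -- The integral over `v_{-1}` moves inside that over the past measurement noise, next to the
  -- future noise.
  rw [lintegral_lintegral_swap]
  swap
  · refine Measurable.aemeasurable ?_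
    refine Measurable.lintegral_prod_right' (f := fun p : (Vec nx × (Fin (L + 1) → Vec ny)) ×
      (Fin (H + 1) → Vec nx) => ∫⁻ w', f ((θ, x, r, v, p.1.2), p.1.1, p.2, w')
        ∂(iidKernel 𝔖.measNoise (H + 1) θ)) ?_
    refine Measurable.lintegral_prod_right' (f := fun p : ((Vec nx × (Fin (L + 1) → Vec ny)) ×
      (Fin (H + 1) → Vec nx)) × (Fin (H + 1) → Vec ny) =>
      f ((θ, x, r, v, p.1.1.2), p.1.1.1, p.1.2, p.2)) ?_
    fun_prop
  refine lintegral_congr fun w => ?_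
  rw [Setting.freshNoise, Kernel.lintegral_prod _ _ _ (by fun_prop)]
  refine lintegral_congr fun a => ?_
  rw [Kernel.lintegral_prod _ _ _ (by fun_prop)]

/-- Redrawing the fresh noise does not change the joint law. -/
lemma Setting.lintegral_redraw
    {f : PastSource nθ nx ny R L × FreshNoise nx ny H → ENNReal} (hf : Measurable f) :
    ∫⁻ τ, f (Truth.pastSource τ, Truth.fresh τ) ∂(𝔖.truthLaw L H) =
      ∫⁻ τ, ∫⁻ n, f (Truth.pastSource τ, n) ∂(𝔖.freshNoise H τ.1) ∂(𝔖.truthLaw L H) := by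
  have hg : Measurable fun p : PastSource nθ nx ny R L × FreshNoise nx ny H =>
      ∫⁻ n, f (p.1, n) ∂(𝔖.freshNoise H p.1.1) := by
    have h := Measurable.lintegral_kernel_prod_right'
      (κ := (𝔖.freshNoise H).comap (Prod.fst : PastSource nθ nx ny R L → Vec nθ) measurable_fst) hf
    exact h.comp measurable_fst
  rw [𝔖.lintegral_truthLaw_pastSource_fresh hf]
  -- On the right the integrand no longer depends on the original fresh noise, whose law integrates
  -- to one.
  refine Eq.trans ?_ (𝔖.lintegral_truthLaw_pastSource_fresh hg).symm
  simp

variable (L H)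

/-- The law of a generated scenario, as a kernel. -/
def Setting.scenarioKernel : Kernel (Data nu ny L) (Scenario nθ nx ny H) :=
  -- The identity factor keeps the data available, since `x_0` depends on `u_{-1}`.
  (Kernel.id ×ₖ (𝔖.posterior L H ⊗ₖ (𝔖.freshNoise H).comap
    (fun p : Data nu ny L × (Vec nθ × (Fin (L + 1) → Vec nx)) => p.2.1)
      (measurable_fst.comp measurable_snd))).map
        (𝔖.assemble L H)

instance : IsMarkovKernel (𝔖.posterior L H) := by
  unfold Setting.posterior
  infer_instance

instance : IsMarkovKernel (𝔖.scenarioKernel L H) := by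
  unfold Setting.scenarioKernel
  exact Kernel.IsMarkovKernel.map _ 𝔖.measurable_assemble

variable {L H}

lemma Setting.lintegral_scenarioKernel (d : Data nu ny L) {f : Scenario nθ nx ny H → ENNReal}
    (hf : Measurable f) :
    ∫⁻ δ, f δ ∂(𝔖.scenarioKernel L H d) =
      ∫⁻ p, ∫⁻ n, f (𝔖.assemble L H (d, p, n)) ∂(𝔖.freshNoise H p.1)
        ∂(𝔖.posterior L H d) := by
  have hm := 𝔖.measurable_assemble (L := L) (H := H)
  have hsec : Measurable fun b : Data nu ny L => ∫⁻ c, f (𝔖.assemble L H (b, c))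
      ∂((𝔖.posterior L H ⊗ₖ (𝔖.freshNoise H).comap
        (fun p : Data nu ny L × (Vec nθ × (Fin (L + 1) → Vec nx)) => p.2.1)
        (measurable_fst.comp measurable_snd)) d) := (hf.comp hm).lintegral_prod_right'
  rw [Setting.scenarioKernel, Kernel.lintegral_map _ hm _ hf,
    Kernel.lintegral_prod _ _ _ (by fun_prop), Kernel.id_apply,
    lintegral_dirac' _ hsec,
    Kernel.lintegral_compProd _ _ _ (by fun_prop)]
  simp only [Kernel.comap_apply]

lemma Setting.lintegral_scenarioLaw (d : Data nu ny L) {f : Scenario nθ nx ny H → ENNReal}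
    (hf : Measurable f) :
    ∫⁻ δ, f δ ∂(𝔖.scenarioLaw L H d) =
      ∫⁻ p, ∫⁻ n, f (𝔖.assemble L H (d, p, n)) ∂(𝔖.freshNoise H p.1)
        ∂(𝔖.posterior L H d) := by
  have hm := 𝔖.measurable_assemble (L := L) (H := H)
  have hm' : Measurable fun p => 𝔖.assemble L H (d, p) := by fun_prop
  rw [Setting.scenarioLaw]
  refine (lintegral_map hf hm').trans ?_
  exact Measure.lintegral_compProd (hf.comp hm')

lemma Setting.scenarioKernel_apply (d : Data nu ny L) :
    𝔖.scenarioKernel L H d = 𝔖.scenarioLaw L H d :=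
  Measure.ext_of_lintegral _ fun f hf => by
    rw [𝔖.lintegral_scenarioKernel d hf, 𝔖.lintegral_scenarioLaw d hf]

instance (d : Data nu ny L) : IsProbabilityMeasure (𝔖.scenarioLaw L H d) := by
  rw [← 𝔖.scenarioKernel_apply]
  infer_instance

/-- The fresh noise is redrawn given the parameters, and the joint law of data and latent variables
is then disintegrated through the posterior. What remains is the recipe for generating a scenario.
-/
lemma Setting.map_dataOf_trueScenarioOf :
    (𝔖.truthLaw L H).map (fun τ => (𝔖.dataOf τ, 𝔖.trueScenarioOf τ)) =
      (𝔖.truthLaw L H).map 𝔖.dataOf ⊗ₘ 𝔖.scenarioKernel L H := by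
  have hm := 𝔖.measurable_assemble (L := L) (H := H)
  have hdl := 𝔖.measurable_dataOf_latentOf (L := L) (H := H)
  have hobs := 𝔖.measurable_observe (L := L)
  refine Measure.ext_of_lintegral _ fun f hf => ?_
  have hF : Measurable fun p : (Data nu ny L × (Vec nθ × (Fin (L + 1) → Vec nx))) ×
      FreshNoise nx ny H => f (p.1.1, 𝔖.assemble L H (p.1.1, p.1.2, p.2)) := by fun_prop
  have hI : Measurable fun p : Data nu ny L × (Vec nθ × (Fin (L + 1) → Vec nx)) =>
      ∫⁻ n, f (p.1, 𝔖.assemble L H (p.1, p.2, n)) ∂(𝔖.freshNoise H p.2.1) :=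
    Measurable.lintegral_kernel_prod_right' (κ := (𝔖.freshNoise H).comap
      (fun p : Data nu ny L × (Vec nθ × (Fin (L + 1) → Vec nx)) => p.2.1)
      (measurable_fst.comp measurable_snd)) hF
  calc ∫⁻ p, f p ∂((𝔖.truthLaw L H).map fun τ => (𝔖.dataOf τ, 𝔖.trueScenarioOf τ))
      = ∫⁻ τ, f (𝔖.dataOf τ, 𝔖.assemble L H (𝔖.dataOf τ, 𝔖.latentOf τ, Truth.fresh τ))
          ∂(𝔖.truthLaw L H) := by
        rw [lintegral_map hf (hdl.fst.prodMk 𝔖.measurable_trueScenarioOf)]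
        simp only [𝔖.trueScenarioOf_eq]
    _ = ∫⁻ τ, ∫⁻ n, f (𝔖.dataOf τ, 𝔖.assemble L H (𝔖.dataOf τ, 𝔖.latentOf τ, n))
          ∂(𝔖.freshNoise H τ.1) ∂(𝔖.truthLaw L H) := by
        have h := 𝔖.lintegral_redraw (L := L) (H := H)
          (hF.comp ((hobs.comp measurable_fst).prodMk measurable_snd))
        simpa only [Function.comp_apply, 𝔖.observe_pastSource] using h
    _ = ∫⁻ p, ∫⁻ n, f (p.1, 𝔖.assemble L H (p.1, p.2, n)) ∂(𝔖.freshNoise H p.2.1)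
          ∂((𝔖.truthLaw L H).map fun τ => (𝔖.dataOf τ, 𝔖.latentOf τ)) := by
        rw [lintegral_map hI hdl]
        rfl
    _ = ∫⁻ d, ∫⁻ δ, f (d, δ) ∂(𝔖.scenarioKernel L H d) ∂((𝔖.truthLaw L H).map 𝔖.dataOf) := by
        rw [← compProd_map_condDistrib hdl.snd.aemeasurable, Measure.lintegral_compProd hI]
        refine lintegral_congr fun d => ?_
        rw [𝔖.lintegral_scenarioKernel d (by fun_prop)]
        rfl
    _ = ∫⁻ p, f p ∂((𝔖.truthLaw L H).map 𝔖.dataOf ⊗ₘ 𝔖.scenarioKernel L H) :=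
        (Measure.lintegral_compProd hf).symm

/-- The exceptional null set involves neither the task nor the solver, so both may be chosen after
the data. -/
lemma Setting.ae_trueScenarioLaw_eq :
    ∀ᵐ d ∂(𝔖.dataLaw L H), 𝔖.trueScenarioLaw L H d = 𝔖.scenarioLaw L H d := by
  have h := condDistrib_ae_eq_of_measure_eq_compProd (μ := 𝔖.truthLaw L H) 𝔖.dataOf
    𝔖.measurable_trueScenarioOf.aemeasurable 𝔖.map_dataOf_trueScenarioOf
  filter_upwards [h] with d hd
  rw [← 𝔖.scenarioKernel_apply]
  exact hd

/-! ### Measurability of the constraints -/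

lemma Model.measurable_simState (𝔐 : Model nθ nx nu ny) (t : Fin (H + 1)) :
    Measurable fun p : Inputs nu H × Scenario nθ nx ny H => 𝔐.simState p.2 p.1 t := by
  induction t using Fin.induction with
  | zero =>
    simp only [Model.simState, Fin.induction_zero]
    fun_prop
  | succ i ih =>
    simp only [Model.simState, Fin.induction_succ]
    simp only [Model.simState] at ih
    fun_prop

lemma Model.measurable_simOutput (𝔐 : Model nθ nx nu ny) :
    Measurable fun p : Inputs nu H × Scenario nθ nx ny H => 𝔐.simOutput p.2 p.1 := by
  refine measurable_pi_lambda _ fun t => ?_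
  have := 𝔐.measurable_simState t
  simp only [Model.simOutput]
  fun_prop

lemma Task.measurableSet_suitable (P : Task nu ny H) (𝔐 : Model nθ nx nu ny) :
    MeasurableSet {p : Inputs nu H × Scenario nθ nx ny H | p.1 ∈ P.suitable 𝔐 p.2} :=
  measurableSet_le (P.measurable_h.comp (measurable_fst.prodMk 𝔐.measurable_simOutput))
    measurable_const

end

end ScenarioOCP

end

/-! ### Proof of the main theorem -/

open ScenarioOCP in
theorem theorem3 {nθ nx nu ny : ℕ} {R : Type*} [MeasurableSpace R]
    (𝔖 : Setting nθ nx nu ny R) (L H K : ℕ) (β : ℝ) (hβ : β ∈ Set.Ioo (0 : ℝ) 1) :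
    ∃ ε : ℕ → ℝ,
      (∀ s < K, ε s ∈ Set.Ioo (0 : ℝ) 1 ∧ riskPoly K s β (ε s) = 0 ∧
        ∀ v ∈ Set.Ioo (0 : ℝ) 1, riskPoly K s β v = 0 → v = ε s) ∧
      ∀ᵐ d ∂(𝔖.dataLaw L H), ∀ (P : Task nu ny H) (solver : Solver nu H),
        (∀ n, Measurable (solver.solution P 𝔖.toModel n)) →
        (∀ n, 1 ≤ n →
          ConsistentAt (solver.solution P 𝔖.toModel) (P.suitable 𝔖.toModel) n) →
        1 - β ≤ (Measure.pi fun _ : Fin K => 𝔖.scenarioLaw L H d).real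
          {δ | (P.ocp 𝔖.toModel δ).Feasible (solver.solution P 𝔖.toModel K δ) →
            ∀ S : Finset (Fin K), S.card < K →
              IsSupportSet (solver.solution P 𝔖.toModel) δ S →
              (S = ∅ →
                ConsistentAt (solver.solution P 𝔖.toModel) (P.suitable 𝔖.toModel) 0) →
              𝔖.violation P L d (solver.solution P 𝔖.toModel K δ) ≤ ε S.card} := by
  have hex : ∀ s, ∃ v : ℝ, s < K → v ∈ Set.Ioo (0 : ℝ) 1 ∧ riskPoly K s β v = 0 := by
    intro s
    by_cases hs : s < K
    · obtain ⟨v, hv, h⟩ := exists_riskPoly_eq_zero hs hβ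
      exact ⟨v, fun _ => ⟨hv, h⟩⟩
    -- The value for `s ≥ K` is arbitrary: only sets with fewer than `K` elements matter.
    · exact ⟨0, fun h => absurd h hs⟩
  choose ε hε using hex
  refine ⟨ε, fun s hs => ⟨(hε s hs).1, (hε s hs).2, fun v hv h =>
    riskPoly_root_unique hs hβ.1 hv.2 (hε s hs).1.2 h (hε s hs).2⟩, ?_⟩
  filter_upwards [𝔖.ae_trueScenarioLaw_eq] with d hd P solver hmeas hcons
  obtain ⟨B, hB, hBβ, hgood⟩ := exists_measure_compl_violation_le (K := K)
    (𝔖.scenarioLaw L H d) hmeas (P.measurableSet_suitable 𝔖.toModel) hcons hβ.1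
    fun s hs => (hε s hs).2
  have hBreal : (Measure.pi fun _ : Fin K => 𝔖.scenarioLaw L H d).real B ≤ β :=
    ENNReal.toReal_le_of_le_ofReal hβ.1.le hBβ
  calc 1 - β ≤ (Measure.pi fun _ : Fin K => 𝔖.scenarioLaw L H d).real Bᶜ := by
        rw [probReal_compl_eq_one_sub hB]
        linarith
    _ ≤ _ := by
        refine measureReal_mono fun δ hδ _ S hS hsupp h0 => ?_
        have h := hgood δ hδ S hS hsupp h0
        -- Here the law of the unknown system is replaced by the law of the generated scenarios.
        rw [Setting.violation, hd]
        convert h using 3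
        simp [Task.suitable]
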